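/- Let $H=\begin{pmatrix} a & b\\ c & d_0\end{pmatrix}\in U(2)$ with $a\,b\,c\,d_0\neq 0$. On $\ell^2(\mathbb Z)\otimes\mathbb C^2$, where $\mathbb C^2$ has orthonormal basis $|L\rangle,|R\rangle$ (in this order), put $U=S(I\otimes H)$, where $S|x\rangle|L\rangle=|x-1\rangle|L\rangle$ and $S|x\rangle|R\rangle=|x+1\rangle|R\rangle$, and let $\rho_0=\tfrac12(|L\rangle\langle L|+|R\rangle\langle R|)$. For $d\in\mathbb N$ let $p_d(x)=\operatorname{Tr}\bigl[\bigl(\operatorname{Tr}_c\,U^d(|0\rangle\langle 0|\otimes\rho_0)U^{d\dagger}\bigr)|x\rangle\langle x|\bigr]$, $x\in\mathbb Z$, be the distribution of the measured position of the walk after $d$ steps, where $\operatorname{Tr}_c$ is the partial trace over the coin $\mathbb C^2$. Let $\beta\in[0,1]$. Let the final time $t$ tend to infinity along a sequence of natural numbers of the form $t=dM$, where the number $d=d(t)$ of steps between measurements and the number $M=M(t)$ of measurements are natural numbers and $d\sim t^{\beta}$ (that is, $d/t^{\beta}\to 1$). Let $X_t=Y^{(d)}_1+\dots+Y^{(d)}_M$,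 where $Y^{(d)}_1,\dots,Y^{(d)}_M$ are i.i.d. with $\Pr(Y^{(d)}_i=x)=p_d(x)$ for $x\in\mathbb Z$ (the position is measured every $d$ steps, and the coin is then re-prepared in the state $\rho_0$). Then, as $t\to\infty$, in distribution, $$\frac{X_t}{t^{(1+\beta)/2}}\Rightarrow\begin{cases}N(0,1) & \text{if }\beta=0,\\ N\bigl(0,\,1-\sqrt{1-|a|^2}\bigr) & \text{if }0<\beta<1,\\ K(|a|) & \text{if }\beta=1,\end{cases}$$ where $N(m,\sigma^2)$ is the normal law with mean $m$ and variance $\sigma^2$ and, for $0<r<1$, $K(r)$ is the probability law on $\mathbb R$ with density $\dfrac{\sqrt{1-r^2}}{\pi(1-x^2)\sqrt{r^2-x^2}}$ on $(-r,r)$ and $0$ elsewhere. -/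

import Mathlib

open MeasureTheory ProbabilityTheory Filter Topology
open scoped InnerProductSpace Asymptotics

/-- The position space `ℓ²(ℤ)`. -/
abbrev PosSpace : Type := lp (fun _ : ℤ => ℂ) 2

/-- The space of the walker, `ℓ²(ℤ) ⊗ ℂ² = ℓ²(ℤ × {L, R})`. The coin basis is `L = 0`, `R = 1`. -/
abbrev WalkSpace : Type := lp (fun _ : ℤ × Fin 2 => ℂ) 2

/-- The position basis vector `|x⟩`. -/
noncomputable def posKet (x : ℤ) : PosSpace := lp.single 2 x 1

/-- The basis vector `|x⟩ ⊗ |c⟩`. -/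
noncomputable def walkKet (x : ℤ) (c : Fin 2) : WalkSpace := lp.single 2 (x, c) 1

theorem orthonormal_single_comp {κ ι : Type} [DecidableEq ι] (f : κ → ι)
    (hf : Function.Injective f) :
    Orthonormal ℂ (fun k : κ => (lp.single 2 (f k) 1 : lp (fun _ : ι => ℂ) 2)) := by
  classical
  rw [orthonormal_iff_ite]
  intro i j
  rw [lp.inner_single_left, lp.single_apply]
  by_cases h : i = j
  · subst h; simp
  · simp [h, hf.ne h]

/-- The linear isometry `ℓ²(κ) → ℓ²(ι)` with `|k⟩ ↦ |f k⟩`, for an injective map `f`. -/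
noncomputable def basisMap {κ ι : Type} [DecidableEq ι] (f : κ → ι)
    (hf : Function.Injective f) : lp (fun _ : κ => ℂ) 2 →L[ℂ] lp (fun _ : ι => ℂ) 2 :=
  (orthonormal_single_comp f hf).orthogonalFamily.linearIsometry.toContinuousLinearMap

theorem basisMap_single {κ ι : Type} [DecidableEq κ] [DecidableEq ι] (f : κ → ι)
    (hf : Function.Injective f) (k : κ) :
    basisMap f hf (lp.single 2 k 1) = lp.single 2 (f k) 1 := by
  refine ((orthonormal_single_comp f hf).orthogonalFamily.linearIsometry_apply_single
    (i := k) (1 : ℂ)).trans ?_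
  simp

theorem injective_coin (c : Fin 2) : Function.Injective (fun x : ℤ => (x, c)) :=
  fun _ _ h => (Prod.ext_iff.mp h).1

/-- The embedding `ψ ↦ ψ ⊗ |c⟩`, i.e. `|x⟩ ↦ |x⟩ ⊗ |c⟩`; its adjoint is `I ⊗ ⟨c|`. -/
noncomputable def tensorCoin (c : Fin 2) : PosSpace →L[ℂ] WalkSpace :=
  basisMap (fun x : ℤ => (x, c)) (injective_coin c)

/-- `I ⊗ A = ∑ A i j (I ⊗ |i⟩⟨j|)` for a `2 × 2` matrix `A` acting on the coin. -/
noncomputable def coinOp (A : Matrix (Fin 2) (Fin 2) ℂ) : WalkSpace →L[ℂ] WalkSpace :=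
  ∑ i, ∑ j, A i j • (tensorCoin i ∘L ContinuousLinearMap.adjoint (tensorCoin j))

/-- The displacement caused by a coin state: `-1` for `L`, `+1` for `R`. -/
def displacement (c : Fin 2) : ℤ := if c = 0 then -1 else 1

theorem injective_displace :
    Function.Injective (fun p : ℤ × Fin 2 => (p.1 + displacement p.2, p.2)) := by
  rintro ⟨x, c⟩ ⟨y, e⟩ h
  obtain ⟨h1, h2⟩ := Prod.ext_iff.mp h
  dsimp only at h1 h2
  subst h2
  exact Prod.ext (add_right_cancel h1) rfl

/-- The shift `S |x⟩|L⟩ = |x-1⟩|L⟩`, `S |x⟩|R⟩ = |x+1⟩|R⟩`. -/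
noncomputable def shiftOp : WalkSpace →L[ℂ] WalkSpace :=
  basisMap (fun p : ℤ × Fin 2 => (p.1 + displacement p.2, p.2)) injective_displace

/-- One step of the walk, `U = S (I ⊗ H)`. -/
noncomputable def walkOp (H : Matrix.unitaryGroup (Fin 2) ℂ) : WalkSpace →L[ℂ] WalkSpace :=
  shiftOp ∘L coinOp H.1

/-- The initial state `|0⟩⟨0| ⊗ ρ₀` with `ρ₀ = (|L⟩⟨L| + |R⟩⟨R|) / 2`. -/
noncomputable def initialState : WalkSpace →L[ℂ] WalkSpace :=
  (1 / 2 : ℂ) • ∑ c, InnerProductSpace.rankOne ℂ (walkKet 0 c) (walkKet 0 c)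

/-- The state after `n` steps, `Uⁿ (|0⟩⟨0| ⊗ ρ₀) (Uⁿ)†`. -/
noncomputable def walkState (H : Matrix.unitaryGroup (Fin 2) ℂ) (n : ℕ) :
    WalkSpace →L[ℂ] WalkSpace :=
  (walkOp H ^ n) ∘L initialState ∘L ContinuousLinearMap.adjoint (walkOp H ^ n)

/-- The partial trace over the coin, `∑ (I ⊗ ⟨c|) A (I ⊗ |c⟩)`. -/
noncomputable def coinTrace (A : WalkSpace →L[ℂ] WalkSpace) : PosSpace →L[ℂ] PosSpace :=
  ∑ c, ContinuousLinearMap.adjoint (tensorCoin c) ∘L A ∘L tensorCoin c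

/-- The trace of an operator on `ℓ²(ℤ)`, computed in the position basis. -/
noncomputable def posTrace (B : PosSpace →L[ℂ] PosSpace) : ℂ :=
  ∑' y, ⟪posKet y, B (posKet y)⟫_ℂ

/-- The probability to find the walker at `x` after `n` steps (Born rule):
`Tr [(Tr_c Uⁿ (|0⟩⟨0| ⊗ ρ₀) (Uⁿ)†) |x⟩⟨x|]`. -/
noncomputable def walkProb (H : Matrix.unitaryGroup (Fin 2) ℂ) (n : ℕ) (x : ℤ) : ℝ :=
  (posTrace (coinTrace (walkState H n) ∘L
    InnerProductSpace.rankOne ℂ (posKet x) (posKet x))).re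

/-- The density of the law `K(r)`. -/
noncomputable def konnoDensity (r x : ℝ) : ℝ :=
  (Set.Ioo (-r) r).indicator
    (fun y => √(1 - r ^ 2) / (Real.pi * (1 - y ^ 2) * √(r ^ 2 - y ^ 2))) x

/-- The law `K(r)` on the real line. -/
noncomputable def konnoLaw (r : ℝ) : Measure ℝ :=
  volume.withDensity (fun x => ENNReal.ofReal (konnoDensity r x))

/-! Fourier transform turns one step into multiplication by `walkSymbol`, the matrix diag(e^{-ik},
e^{ik}) H. Divided by a square root of det H it lies in SU(2), with eigenvalues e^{±iω}, where cos ω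
= r cos κ, r = |a| and κ is a translate of k. As ρ₀ is maximally mixed, Parseval writes the
characteristic function φ_d(ξ) of p_d as the mean over κ of half the trace of V(κ)⁻ᵈ V(κ+ξ)ᵈ
(`sum_walkProb_mul_exp`). At ξ = s/d this trace tends to cos(s ω'(κ)) (`tendsto_walkKernel`):
position over d behaves like the group velocity ω'(κ) at a uniform κ, whose law is K(r)
(`konnoLaw_eq_smul_map`, `charFun_konnoLaw`).

The characteristic function of X_t is φ_d to the power M. If β = 1, then t = dM and d ~ t force M =
1 eventually, and the limit is K(r). If β < 1, the scaled frequency ξ satisfies ξd → 0 and M(ξd)² →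
s². Since |x| ≤ d on the support, φ_d(ξ) = 1 - ξ²m_d/2 + O((ξd)⁴) uniformly in d, where m_d is the
second moment, so the power tends to exp(-s²v/2) with v = lim m_d/d²
(`tendsto_walkCharFun_pow_gaussian`). For β = 0, d is eventually 1 and v = 1; for 0 < β < 1, v is
the mean of ω'², which is 1 - √(1-r²) (`tendsto_walkSecondMoment_div_sq`,
`integral_groupVelocity_sq`). Lévy's continuity theorem concludes. -/

/-! ### The operators in coordinates. -/

theorem inner_single_one {ι : Type} [DecidableEq ι] (i : ι) (ψ : lp (fun _ : ι => ℂ) 2) :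
    ⟪(lp.single 2 i 1 : lp (fun _ : ι => ℂ) 2), ψ⟫_ℂ = ψ i := by
  rw [lp.inner_single_left]; simp

theorem basisMap_apply {κ ι : Type} [DecidableEq κ] [DecidableEq ι] (f : κ → ι)
    (hf : Function.Injective f) (ψ : lp (fun _ : κ => ℂ) 2) (k : κ) :
    basisMap f hf ψ (f k) = ψ k := by
  rw [← inner_single_one, ← basisMap_single f hf, ← inner_single_one k ψ]
  exact (orthonormal_single_comp f hf).orthogonalFamily.linearIsometry.inner_map_map _ _

theorem basisMap_apply_of_notMem_range {κ ι : Type} [DecidableEq ι] (f : κ → ι)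
    (hf : Function.Injective f) (ψ : lp (fun _ : κ => ℂ) 2) {i : ι} (hi : i ∉ Set.range f) :
    basisMap f hf ψ i = 0 := by
  have h := (orthonormal_single_comp f hf).orthogonalFamily.hasSum_linearIsometry ψ
  have h2 := h.mapL (innerSL ℂ (lp.single 2 i 1 : lp (fun _ : ι => ℂ) 2))
  have h3 : ∀ k, innerSL ℂ (lp.single 2 i 1 : lp (fun _ : ι => ℂ) 2)
      (LinearIsometry.toSpanSingleton ℂ _ ((orthonormal_single_comp f hf).1 k) (ψ k)) = 0 := by
    intro k
    have hne : f k ≠ i := fun h => hi ⟨k, h⟩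
    simp [inner_single_one, lp.single_apply, hne.symm]
  simp only [h3] at h2
  rw [← inner_single_one]
  exact (h2.unique hasSum_zero)

theorem adjoint_tensorCoin_apply (c : Fin 2) (ψ : WalkSpace) (x : ℤ) :
    (ContinuousLinearMap.adjoint (tensorCoin c) ψ : PosSpace) x = ψ (x, c) := by
  rw [← inner_single_one, ContinuousLinearMap.adjoint_inner_right, tensorCoin, basisMap_single,
    inner_single_one]

theorem tensorCoin_apply (c : Fin 2) (ψ : PosSpace) (x : ℤ) (e : Fin 2) :
    tensorCoin c ψ (x, e) = if e = c then ψ x else 0 := by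
  split_ifs with h
  · subst h
    exact basisMap_apply (fun x : ℤ => (x, e)) (injective_coin e) ψ x
  · refine basisMap_apply_of_notMem_range _ _ _ ?_
    rintro ⟨y, hy⟩
    exact h (Prod.ext_iff.mp hy).2.symm

theorem coinOp_apply (A : Matrix (Fin 2) (Fin 2) ℂ) (ψ : WalkSpace) (x : ℤ) (c : Fin 2) :
    coinOp A ψ (x, c) = ∑ j, A c j * ψ (x, j) := by
  simp only [coinOp, Fin.sum_univ_two, add_apply, smul_apply,
    ContinuousLinearMap.comp_apply]
  let T : Fin 2 → Fin 2 → WalkSpace := fun i j =>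
    tensorCoin i (ContinuousLinearMap.adjoint (tensorCoin j) ψ)
  change (A 0 0 * T 0 0 (x, c) + A 0 1 * T 0 1 (x, c)) +
    (A 1 0 * T 1 0 (x, c) + A 1 1 * T 1 1 (x, c)) = _
  simp only [T, tensorCoin_apply, adjoint_tensorCoin_apply]
  fin_cases c <;> simp

theorem shiftOp_apply (ψ : WalkSpace) (x : ℤ) (c : Fin 2) :
    shiftOp ψ (x, c) = ψ (x - displacement c, c) := by
  have h := basisMap_apply (fun p : ℤ × Fin 2 => (p.1 + displacement p.2, p.2)) injective_displace
    ψ (x - displacement c, c)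
  simpa [shiftOp] using h

theorem walkOp_apply (H : Matrix.unitaryGroup (Fin 2) ℂ) (ψ : WalkSpace) (x : ℤ) (c : Fin 2) :
    walkOp H ψ (x, c) = ∑ j, H.1 c j * ψ (x - displacement c, j) := by
  rw [walkOp, ContinuousLinearMap.comp_apply, shiftOp_apply, coinOp_apply]

/-! ### Amplitudes: recursion, light cone, Born rule. -/

/-- The amplitude `⟨x, c| Uⁿ |0, e⟩`. -/
noncomputable def amplitude (H : Matrix.unitaryGroup (Fin 2) ℂ) (n : ℕ) (x : ℤ) (c e : Fin 2) : ℂ :=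
  (walkOp H ^ n) (walkKet 0 e) (x, c)

theorem amplitude_zero (H : Matrix.unitaryGroup (Fin 2) ℂ) (x : ℤ) (c e : Fin 2) :
    amplitude H 0 x c e = if x = 0 ∧ c = e then 1 else 0 := by
  simp [amplitude, walkKet, lp.single_apply, Pi.single_apply]

theorem amplitude_succ (H : Matrix.unitaryGroup (Fin 2) ℂ) (n : ℕ) (x : ℤ) (c e : Fin 2) :
    amplitude H (n + 1) x c e = ∑ j, H.1 c j * amplitude H n (x - displacement c) j e := by
  rw [amplitude, pow_succ', mul_apply_eq_comp, walkOp_apply]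
  rfl

theorem abs_displacement (c : Fin 2) : |displacement c| = 1 := by
  fin_cases c <;> simp [displacement]

theorem amplitude_eq_zero (H : Matrix.unitaryGroup (Fin 2) ℂ) (n : ℕ) (x : ℤ) (c e : Fin 2)
    (hx : (n : ℤ) < |x|) : amplitude H n x c e = 0 := by
  induction n generalizing x c with
  | zero =>
    rw [amplitude_zero, if_neg]
    rintro ⟨rfl, -⟩
    simp at hx
  | succ n ih =>
    rw [amplitude_succ]
    refine Finset.sum_eq_zero fun j _ => ?_
    rw [ih, mul_zero]
    have h1 := abs_sub_abs_le_abs_sub x (displacement c)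
    rw [abs_displacement] at h1
    push_cast at hx
    linarith

theorem walkProb_eq_sum_amplitude (H : Matrix.unitaryGroup (Fin 2) ℂ) (n : ℕ) (x : ℤ) :
    walkProb H n x = (1 / 2) * ∑ c, ∑ e, ‖amplitude H n x c e‖ ^ 2 := by
  have hstate : ∀ ψ : WalkSpace, walkState H n ψ = (1 / 2 : ℂ) • ∑ e,
      ⟪(walkOp H ^ n) (walkKet 0 e), ψ⟫_ℂ • (walkOp H ^ n) (walkKet 0 e) := by
    intro ψ
    simp only [walkState, initialState, ContinuousLinearMap.comp_apply,
      smul_apply, sum_apply,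
      InnerProductSpace.rankOne_apply, map_smul, map_sum, ContinuousLinearMap.adjoint_inner_right]
  have htrace : ∀ B : PosSpace →L[ℂ] PosSpace,
      posTrace (B ∘L InnerProductSpace.rankOne ℂ (posKet x) (posKet x)) =
        ⟪posKet x, B (posKet x)⟫_ℂ := by
    intro B
    rw [posTrace, tsum_eq_single x]
    · simp [posKet]
    · intro y hy
      simp [posKet, inner_single_one, lp.single_apply, hy.symm]
  have hcoin : ∀ c, tensorCoin c (posKet x) = walkKet x c := fun c =>
    basisMap_single (fun x : ℤ => (x, c)) (injective_coin c) x
  rw [walkProb, htrace, coinTrace]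
  simp only [sum_apply, ContinuousLinearMap.comp_apply, inner_sum,
    ContinuousLinearMap.adjoint_inner_right, hcoin, hstate, inner_smul_right]
  have hterm : ∀ c e, ⟪(walkOp H ^ n) (walkKet 0 e), walkKet x c⟫_ℂ *
      ⟪walkKet x c, (walkOp H ^ n) (walkKet 0 e)⟫_ℂ = ((‖amplitude H n x c e‖ ^ 2 : ℝ) : ℂ) := by
    intro c e
    rw [← inner_conj_symm, walkKet, inner_single_one, ← Complex.normSq_eq_conj_mul_self,
      Complex.normSq_eq_norm_sq]
    rfl
  simp only [hterm, ← Finset.mul_sum]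
  rw [← Complex.ofReal_re ((1 / 2) * ∑ c, ∑ e, ‖amplitude H n x c e‖ ^ 2)]
  push_cast
  rfl

/-! ### Fourier transform and Parseval. -/

/-- The walk operator in Fourier space, `diag(e^{-ik}, e^{ik}) H`. -/
noncomputable def walkSymbol (H : Matrix (Fin 2) (Fin 2) ℂ) (k : ℝ) : Matrix (Fin 2) (Fin 2) ℂ :=
  Matrix.of fun c j => Complex.exp (k * displacement c * Complex.I) * H c j

theorem hasSum_amplitude (H : Matrix.unitaryGroup (Fin 2) ℂ) (n : ℕ) (c e : Fin 2) (k : ℝ) :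
    HasSum (fun x : ℤ => Complex.exp (k * x * Complex.I) * amplitude H n x c e)
      ((walkSymbol H.1 k ^ n) c e) := by
  induction n generalizing c with
  | zero =>
    convert! hasSum_ite_eq (0 : ℤ) ((1 : Matrix (Fin 2) (Fin 2) ℂ) c e) using 2 with x
    by_cases hx : x = 0 <;> simp [amplitude_zero, hx, Matrix.one_apply]
  | succ n ih =>
    rw [pow_succ', Matrix.mul_apply]
    have h1 : HasSum (fun x : ℤ => ∑ j, walkSymbol H.1 k c j *
        (Complex.exp (k * x * Complex.I) * amplitude H n x j e))
        (∑ j, walkSymbol H.1 k c j * (walkSymbol H.1 k ^ n) j e) :=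
      hasSum_sum fun j _ => (ih j).mul_left _
    rw [← (Equiv.subRight (displacement c)).hasSum_iff] at h1
    convert! h1 using 2 with x
    simp only [Function.comp_apply, Equiv.subRight_apply, amplitude_succ, Finset.mul_sum]
    refine Finset.sum_congr rfl fun j _ => ?_
    have : Complex.exp (k * x * Complex.I) = Complex.exp (k * displacement c * Complex.I) *
        Complex.exp (k * ((x - displacement c : ℤ) : ℂ) * Complex.I) := by
      rw [← Complex.exp_add]; congr 1; push_cast; ring
    rw [this, walkSymbol, Matrix.of_apply]
    ring

theorem sum_amplitude (H : Matrix.unitaryGroup (Fin 2) ℂ) (n : ℕ) (c e : Fin 2) (k : ℝ) :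
    (walkSymbol H.1 k ^ n) c e = ∑ x ∈ Finset.Icc (-n : ℤ) n,
      Complex.exp (k * x * Complex.I) * amplitude H n x c e := by
  refine (hasSum_amplitude H n c e k).unique (hasSum_sum_of_ne_finset_zero fun x hx => ?_)
  rw [amplitude_eq_zero, mul_zero]
  rw [Finset.mem_Icc, ← abs_le] at hx
  exact not_le.mp hx

-- Parseval for a trigonometric sum and its translate: translating by ξ in Fourier space multiplies
-- the coefficient at x by e^{iξx}.
open ComplexConjugate in
theorem integral_conj_trigSum_mul_trigSum (s : Finset ℤ) (a : ℤ → ℂ) (ξ : ℝ) :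
    ∫ k in (0 : ℝ)..2 * Real.pi, conj (∑ x ∈ s, Complex.exp (k * x * Complex.I) * a x) *
        ∑ y ∈ s, Complex.exp ((k + ξ : ℝ) * y * Complex.I) * a y =
      2 * Real.pi * ∑ x ∈ s, ((‖a x‖ ^ 2 : ℝ) : ℂ) * Complex.exp (ξ * x * Complex.I) := by
  have hexp : ∀ m : ℤ, ∫ k in (0 : ℝ)..2 * Real.pi, Complex.exp (m * Complex.I * k) =
      if m = 0 then 2 * Real.pi else 0 := by
    intro m
    split_ifs with hm
    · simp [hm]
    · rw [integral_exp_mul_complex (by simpa using hm)]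
      have : (m * Complex.I * ((2 * Real.pi : ℝ) : ℂ)) = m * (2 * Real.pi * Complex.I) := by
        push_cast; ring
      rw [this, Complex.exp_int_mul_two_pi_mul_I]
      simp
  have hint : ∀ k : ℝ, conj (∑ x ∈ s, Complex.exp (k * x * Complex.I) * a x) *
        ∑ y ∈ s, Complex.exp ((k + ξ : ℝ) * y * Complex.I) * a y =
      ∑ x ∈ s, ∑ y ∈ s, (conj (a x) * a y * Complex.exp (ξ * y * Complex.I)) *
        Complex.exp (((y - x : ℤ) : ℂ) * Complex.I * k) := by
    intro k
    rw [map_sum, Finset.sum_mul_sum]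
    refine Finset.sum_congr rfl fun x _ => Finset.sum_congr rfl fun y _ => ?_
    rw [map_mul, ← Complex.exp_conj]
    have h1 : conj (k * x * Complex.I : ℂ) = -(k * x * Complex.I) := by simp
    have h2 : Complex.exp (-(k * x * Complex.I)) * Complex.exp ((k + ξ : ℝ) * y * Complex.I) =
        Complex.exp (ξ * y * Complex.I) * Complex.exp (((y - x : ℤ) : ℂ) * Complex.I * k) := by
      rw [← Complex.exp_add, ← Complex.exp_add]; congr 1; push_cast; ring
    rw [h1]
    linear_combination (conj (a x) * a y) * h2
  simp only [hint]
  rw [intervalIntegral.integral_finsetSum fun x _ =>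
    (Continuous.intervalIntegrable (by fun_prop) _ _), Finset.mul_sum]
  refine Finset.sum_congr rfl fun x hx => ?_
  rw [intervalIntegral.integral_finsetSum fun x _ =>
    (Continuous.intervalIntegrable (by fun_prop) _ _)]
  simp only [intervalIntegral.integral_const_mul, hexp, sub_eq_zero]
  rw [Finset.sum_eq_single x]
  · rw [if_pos rfl, ← Complex.normSq_eq_norm_sq, Complex.normSq_eq_conj_mul_self]
    push_cast
    ring
  · intro y _ hy
    simp [hy]
  · simp [hx]

open ComplexConjugate in
theorem sum_walkProb_mul_exp_eq_integral (H : Matrix.unitaryGroup (Fin 2) ℂ) (n : ℕ) (ξ : ℝ) :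
    ∑ x ∈ Finset.Icc (-n : ℤ) n, (walkProb H n x : ℂ) * Complex.exp (ξ * x * Complex.I) =
      (1 / (2 * Real.pi)) * ∫ k in (0 : ℝ)..2 * Real.pi, (1 / 2 : ℂ) * ∑ c, ∑ e,
        conj ((walkSymbol H.1 k ^ n) c e) * (walkSymbol H.1 (k + ξ) ^ n) c e := by
  have hpi : (Real.pi : ℂ) ≠ 0 := by exact_mod_cast Real.pi_ne_zero
  have h : ∀ c e, ∫ k in (0 : ℝ)..2 * Real.pi,
        conj ((walkSymbol H.1 k ^ n) c e) * (walkSymbol H.1 (k + ξ) ^ n) c e =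
      2 * Real.pi * ∑ x ∈ Finset.Icc (-n : ℤ) n,
        ((‖amplitude H n x c e‖ ^ 2 : ℝ) : ℂ) * Complex.exp (ξ * x * Complex.I) := by
    intro c e
    simp only [sum_amplitude]
    exact integral_conj_trigSum_mul_trigSum _ (fun x => amplitude H n x c e) ξ
  have hcont : ∀ c e, Continuous fun k : ℝ =>
      conj ((walkSymbol H.1 k ^ n) c e) * (walkSymbol H.1 (k + ξ) ^ n) c e := by
    intro c e
    simp only [sum_amplitude]
    refine (Complex.continuous_conj.comp ?_).mul ?_ <;> fun_prop
  rw [intervalIntegral.integral_const_mul, intervalIntegral.integral_finsetSum fun c _ =>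
    (continuous_finsetSum _ fun e _ => hcont c e).intervalIntegrable _ _]
  simp only [intervalIntegral.integral_finsetSum fun e _ => (hcont _ e).intervalIntegrable _ _, h]
  simp only [walkProb_eq_sum_amplitude, Fin.sum_univ_two, ← mul_add, ← Finset.sum_add_distrib]
  rw [← mul_assoc, ← mul_assoc, Finset.mul_sum]
  refine Finset.sum_congr rfl fun x _ => ?_
  push_cast
  field_simp

/-! ### Powers of the symbol in SU(2). -/

open ComplexConjugate in
/-- The matrix with first row `(p, q)` of the shape of an element of `SU(2)`. -/
noncomputable def quaternionMatrix (p q : ℂ) : Matrix (Fin 2) (Fin 2) ℂ :=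
  !![p, q; -conj q, conj p]

open ComplexConjugate in
theorem quaternionMatrix_mul (p q p' q' : ℂ) :
    quaternionMatrix p q * quaternionMatrix p' q' =
      quaternionMatrix (p * p' - q * conj q') (p * q' + q * conj p') := by
  ext i j
  fin_cases i <;> fin_cases j <;> simp [quaternionMatrix, Matrix.mul_apply] <;> ring

-- A unit quaternion is cos θ + sin θ · N with N² = -1, so de Moivre's formula applies: its n-th
-- power keeps the direction N and replaces θ by nθ.
open ComplexConjugate in
theorem quaternionMatrix_pow {p q : ℂ} (h : Complex.normSq p + Complex.normSq q = 1) {θ : ℝ}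
    (hθ : Real.cos θ = p.re) (hs : Real.sin θ ≠ 0) (n : ℕ) :
    quaternionMatrix p q ^ n = quaternionMatrix
      (Real.cos (n * θ) + (Real.sin (n * θ) / Real.sin θ * p.im : ℝ) * Complex.I)
      ((Real.sin (n * θ) / Real.sin θ : ℝ) * q) := by
  induction n with
  | zero =>
    ext i j
    fin_cases i <;> fin_cases j <;> simp [quaternionMatrix]
  | succ n ih =>
    have hq : q.re * q.re + q.im * q.im = Real.sin θ ^ 2 - p.im * p.im := by
      rw [Complex.normSq_apply, Complex.normSq_apply, ← hθ] at h
      nlinarith [Real.sin_sq_add_cos_sq θ]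
    rw [pow_succ, ih, quaternionMatrix_mul, Nat.cast_succ, add_one_mul, Real.cos_add,
      Real.sin_add]
    generalize Real.sin (n * θ) = S at *
    generalize Real.cos (n * θ) = C at *
    generalize Real.sin θ = s at *
    generalize Real.cos θ = c at *
    congr 1
    · apply Complex.ext <;> simp
      · rw [← hθ]
        field_simp
        linear_combination (-S) * hq
      · rw [← hθ]
        field_simp
        ring
    · apply Complex.ext <;> simp
      · rw [← hθ]
        field_simp
        ring
      · rw [← hθ]
        field_simp
        ring

-- Half the trace of A†B is the Euclidean inner product of the two quaternions in ℝ⁴; in particular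
-- it is real.
open ComplexConjugate in
theorem sum_conj_quaternionMatrix_mul (p q p' q' : ℂ) :
    (1 / 2 : ℂ) * ∑ c, ∑ e, conj (quaternionMatrix p q c e) * quaternionMatrix p' q' c e =
      ((p.re * p'.re + p.im * p'.im + q.re * q'.re + q.im * q'.im : ℝ) : ℂ) := by
  simp only [quaternionMatrix, Fin.sum_univ_two]
  apply Complex.ext <;> simp <;> ring

-- Here w is a square root of det H. The diagonal phases have determinant one, so dividing by w puts
-- the whole symbol in SU(2), where the first row determines the second.
open ComplexConjugate in
theorem exists_walkSymbol_eq_smul_quaternionMatrix (H : Matrix.unitaryGroup (Fin 2) ℂ) :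
    ∃ w : ℂ, ‖w‖ = 1 ∧ ∀ k : ℝ, walkSymbol H.1 k = w • quaternionMatrix
      (Complex.exp (-k * Complex.I) * (conj w * H.1 0 0))
      (Complex.exp (-k * Complex.I) * (conj w * H.1 0 1)) := by
  obtain ⟨w, hw⟩ := IsAlgClosed.exists_pow_nat_eq (Matrix.det H.1) (n := 2) (by norm_num)
  have hdet : ‖Matrix.det H.1‖ = 1 :=
    CStarRing.norm_of_mem_unitary (Matrix.det_of_mem_unitary H.2)
  have hnorm : ‖w‖ = 1 := by
    rw [← hw, norm_pow] at hdet
    exact (pow_eq_one_iff_of_nonneg (norm_nonneg _) (by norm_num)).1 hdet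
  have hww : w * conj w = 1 := by
    rw [Complex.mul_conj, Complex.normSq_eq_norm_sq, hnorm]; simp
  have hU := Matrix.mem_unitaryGroup_iff.1 H.2
  have h00 := congrFun (congrFun hU 0) 0
  have h01 := congrFun (congrFun hU 0) 1
  have h10 := congrFun (congrFun hU 1) 0
  have h11 := congrFun (congrFun hU 1) 1
  simp only [Matrix.mul_apply, Fin.sum_univ_two, Matrix.star_apply, RCLike.star_def,
    Matrix.one_apply] at h00 h01 h10 h11
  norm_num at h00 h01 h10 h11
  rw [Matrix.det_fin_two] at hw
  -- These two identities say that the inverse of H is both its adjoint and its adjugate divided by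
  -- det H.
  have hd : H.1 1 1 = w ^ 2 * conj (H.1 0 0) := by
    rw [hw]; linear_combination (-H.1 1 1) * h00 + H.1 0 1 * h10
  have hc : H.1 1 0 = -(w ^ 2 * conj (H.1 0 1)) := by
    rw [hw]; linear_combination (-H.1 1 0) * h00 + H.1 0 0 * h10
  refine ⟨w, hnorm, fun k => ?_⟩
  have hconj : conj (Complex.exp (-k * Complex.I)) = Complex.exp (k * Complex.I) := by
    rw [← Complex.exp_conj]; simp
  ext i j
  fin_cases i <;> fin_cases j <;>
    simp [walkSymbol, quaternionMatrix, displacement, hconj, hd, hc, -neg_mul]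
  · linear_combination (-Complex.exp (-k * Complex.I) * H.1 0 0) * hww
  · linear_combination (-Complex.exp (-k * Complex.I) * H.1 0 1) * hww
  · ring
  · ring

/-! ### Dispersion relation, and the limit of the kernel. -/

/-- The quasi-energy `ω(κ)` of the walk, `cos ω = r cos κ`. -/
noncomputable def quasiEnergy (r κ : ℝ) : ℝ := Real.arccos (r * Real.cos κ)

/-- The group velocity `ω'(κ)`. -/
noncomputable def groupVelocity (r κ : ℝ) : ℝ :=
  r * Real.sin κ / √(1 - r ^ 2 * Real.cos κ ^ 2)

/-- The normalized trace of `V(κ)⁻ⁿ V(κ + ξ)ⁿ`, where `V` is the symbol of the walk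
normalized to determinant one. -/
noncomputable def walkKernel (r : ℝ) (n : ℕ) (ξ κ : ℝ) : ℝ :=
  Real.cos (n * quasiEnergy r κ) * Real.cos (n * quasiEnergy r (κ + ξ)) +
    Real.sin (n * quasiEnergy r κ) * Real.sin (n * quasiEnergy r (κ + ξ)) *
      ((r ^ 2 * Real.sin κ * Real.sin (κ + ξ) + (1 - r ^ 2) * Real.cos ξ) /
        (√(1 - r ^ 2 * Real.cos κ ^ 2) * √(1 - r ^ 2 * Real.cos (κ + ξ) ^ 2)))

section

variable {r : ℝ}

theorem one_sub_sq_le_one_sub_sq_mul_cos_sq (r κ : ℝ) :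
    1 - r ^ 2 ≤ 1 - r ^ 2 * Real.cos κ ^ 2 := by
  nlinarith [Real.cos_sq_le_one κ, sq_nonneg r]

theorem one_sub_sq_pos (h0 : 0 ≤ r) (h1 : r < 1) : 0 < 1 - r ^ 2 := by nlinarith

theorem one_sub_sq_mul_cos_sq_pos (h0 : 0 ≤ r) (h1 : r < 1) (κ : ℝ) :
    0 < 1 - r ^ 2 * Real.cos κ ^ 2 :=
  (one_sub_sq_pos h0 h1).trans_le (one_sub_sq_le_one_sub_sq_mul_cos_sq r κ)

theorem sqrt_one_sub_sq_mul_cos_sq_pos (h0 : 0 ≤ r) (h1 : r < 1) (κ : ℝ) :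
    0 < √(1 - r ^ 2 * Real.cos κ ^ 2) :=
  Real.sqrt_pos.2 (one_sub_sq_mul_cos_sq_pos h0 h1 κ)

theorem abs_mul_cos_lt_one (h0 : 0 ≤ r) (h1 : r < 1) (κ : ℝ) : |r * Real.cos κ| < 1 := by
  rw [← sq_lt_one_iff_abs_lt_one, mul_pow]
  linarith [one_sub_sq_mul_cos_sq_pos h0 h1 κ]

theorem cos_quasiEnergy (h0 : 0 ≤ r) (h1 : r < 1) (κ : ℝ) :
    Real.cos (quasiEnergy r κ) = r * Real.cos κ :=
  have h := abs_lt.1 (abs_mul_cos_lt_one h0 h1 κ)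
  Real.cos_arccos h.1.le h.2.le

theorem sin_quasiEnergy (r κ : ℝ) :
    Real.sin (quasiEnergy r κ) = √(1 - r ^ 2 * Real.cos κ ^ 2) := by
  rw [quasiEnergy, Real.sin_arccos, mul_pow]

theorem hasDerivAt_quasiEnergy (h0 : 0 ≤ r) (h1 : r < 1) (κ : ℝ) :
    HasDerivAt (quasiEnergy r) (groupVelocity r κ) κ := by
  have h := abs_lt.1 (abs_mul_cos_lt_one h0 h1 κ)
  have h2 := (Real.hasDerivAt_arccos h.1.ne' h.2.ne).comp κ ((Real.hasDerivAt_cos κ).const_mul r)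
  convert! h2 using 1
  rw [groupVelocity, mul_pow]
  ring

theorem continuous_quasiEnergy (r : ℝ) : Continuous (quasiEnergy r) := by
  unfold quasiEnergy; fun_prop

theorem continuous_groupVelocity (h0 : 0 ≤ r) (h1 : r < 1) : Continuous (groupVelocity r) :=
  Continuous.div (by fun_prop) (by fun_prop) fun κ => (sqrt_one_sub_sq_mul_cos_sq_pos h0 h1 κ).ne'

theorem continuous_walkKernel (h0 : 0 ≤ r) (h1 : r < 1) (n : ℕ) (ξ : ℝ) :
    Continuous (walkKernel r n ξ) := by
  have := continuous_quasiEnergy r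
  refine Continuous.add (by fun_prop) (Continuous.mul (by fun_prop) ?_)
  refine Continuous.div (by fun_prop) (by fun_prop) fun κ => ?_
  exact (mul_pos (sqrt_one_sub_sq_mul_cos_sq_pos h0 h1 _)
    (sqrt_one_sub_sq_mul_cos_sq_pos h0 h1 _)).ne'

/-- A crude bound, uniform in n, ξ and κ, to serve as the dominating function. -/
theorem abs_walkKernel_le (h0 : 0 ≤ r) (h1 : r < 1) (n : ℕ) (ξ κ : ℝ) :
    |walkKernel r n ξ κ| ≤ 1 + 2 / (1 - r ^ 2) := by
  have hr := one_sub_sq_pos h0 h1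
  have hcos : ∀ x y, |Real.cos x * Real.cos y| ≤ 1 := fun x y => by
    rw [abs_mul]; exact mul_le_one₀ (Real.abs_cos_le_one _) (abs_nonneg _) (Real.abs_cos_le_one _)
  have hsin : ∀ x y, |Real.sin x * Real.sin y| ≤ 1 := fun x y => by
    rw [abs_mul]; exact mul_le_one₀ (Real.abs_sin_le_one _) (abs_nonneg _) (Real.abs_sin_le_one _)
  refine (abs_add_le _ _).trans (add_le_add (hcos _ _) ?_)
  rw [abs_mul, abs_div]
  have hnum : |r ^ 2 * Real.sin κ * Real.sin (κ + ξ) + (1 - r ^ 2) * Real.cos ξ| ≤ 2 := by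
    refine (abs_add_le _ _).trans ?_
    rw [mul_assoc, abs_mul, abs_mul (1 - r ^ 2), abs_of_nonneg (sq_nonneg r), abs_of_pos hr]
    nlinarith [hsin κ (κ + ξ), Real.abs_cos_le_one ξ, sq_nonneg r]
  have hden : 1 - r ^ 2 ≤
      |√(1 - r ^ 2 * Real.cos κ ^ 2) * √(1 - r ^ 2 * Real.cos (κ + ξ) ^ 2)| := by
    rw [abs_of_nonneg (by positivity), ← Real.sqrt_mul (one_sub_sq_mul_cos_sq_pos h0 h1 κ).le]
    refine Real.le_sqrt_of_sq_le ?_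
    rw [sq]
    exact mul_le_mul (one_sub_sq_le_one_sub_sq_mul_cos_sq r κ)
      (one_sub_sq_le_one_sub_sq_mul_cos_sq r _) hr.le (one_sub_sq_mul_cos_sq_pos h0 h1 κ).le
  calc _ ≤ 1 * (2 / (1 - r ^ 2)) := by
        refine mul_le_mul (hsin _ _) ?_ (by positivity) zero_le_one
        exact div_le_div₀ zero_le_two hnum hr hden
    _ = _ := one_mul _

/-- The geometric factor multiplying the sines tends to 1, so the kernel is asymptotically the
cosine of the phase difference d(ω(κ+s/d) - ω(κ)), which is a difference quotient tending to s
ω'(κ). -/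
theorem tendsto_walkKernel (h0 : 0 ≤ r) (h1 : r < 1) {d : ℕ → ℕ} (hd : Tendsto d atTop atTop)
    (s κ : ℝ) : Tendsto (fun n => walkKernel r (d n) (s / d n) κ) atTop
      (𝓝 (Real.cos (s * groupVelocity r κ))) := by
  have hd' : Tendsto (fun n => (d n : ℝ)) atTop atTop := tendsto_natCast_atTop_atTop.comp hd
  have hξ : Tendsto (fun n => s / (d n : ℝ)) atTop (𝓝 0) := tendsto_const_nhds.div_atTop hd'
  have hω : Tendsto (fun n => d n * quasiEnergy r (κ + s / d n) - d n * quasiEnergy r κ) atTop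
      (𝓝 (s * groupVelocity r κ)) := by
    have hderiv : HasDerivAt (fun x => quasiEnergy r (κ + s * x)) (s * groupVelocity r κ) 0 := by
      have h := hasDerivAt_quasiEnergy h0 h1 (κ + s * 0)
      have h2 : HasDerivAt (fun x : ℝ => κ + s * x) s 0 := by
        simpa using ((hasDerivAt_id (0 : ℝ)).const_mul s).const_add κ
      have h3 := h.comp 0 h2
      rw [mul_comm, mul_zero, add_zero] at h3
      exact h3
    have hslope := hderiv.tendsto_slope_zero.comp (f := fun n => ((d n : ℝ))⁻¹) (x := atTop)
      (tendsto_nhdsWithin_iff.2 ⟨tendsto_inv_atTop_zero.comp hd', by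
        filter_upwards [hd'.eventually_gt_atTop 0] with n hn
        exact (inv_pos.2 hn).ne'⟩)
    refine hslope.congr fun n => ?_
    simp [mul_sub, div_eq_mul_inv]
  have hG : Tendsto (fun n => (r ^ 2 * Real.sin κ * Real.sin (κ + s / d n) +
      (1 - r ^ 2) * Real.cos (s / d n)) /
        (√(1 - r ^ 2 * Real.cos κ ^ 2) * √(1 - r ^ 2 * Real.cos (κ + s / d n) ^ 2)))
      atTop (𝓝 1) := by
    have hc : ContinuousAt (fun ξ => (r ^ 2 * Real.sin κ * Real.sin (κ + ξ) +
        (1 - r ^ 2) * Real.cos ξ) /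
        (√(1 - r ^ 2 * Real.cos κ ^ 2) * √(1 - r ^ 2 * Real.cos (κ + ξ) ^ 2))) 0 := by
      refine ContinuousAt.div (by fun_prop) (by fun_prop) ?_
      exact (mul_pos (sqrt_one_sub_sq_mul_cos_sq_pos h0 h1 _)
        (sqrt_one_sub_sq_mul_cos_sq_pos h0 h1 _)).ne'
    have h := hc.tendsto.comp hξ
    convert! h using 2
    have hpos := one_sub_sq_mul_cos_sq_pos h0 h1 κ
    rw [add_zero, Real.cos_zero, Real.mul_self_sqrt hpos.le, eq_comm, div_eq_one_iff_eq hpos.ne']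
    linear_combination r ^ 2 * Real.sin_sq_add_cos_sq κ
  -- The phases dω themselves need not converge; only the deviation of the geometric factor from 1
  -- is made small, against bounded sines.
  have hrem : Tendsto (fun n => Real.sin (d n * quasiEnergy r κ) *
      Real.sin (d n * quasiEnergy r (κ + s / d n)) * ((r ^ 2 * Real.sin κ *
        Real.sin (κ + s / d n) + (1 - r ^ 2) * Real.cos (s / d n)) /
        (√(1 - r ^ 2 * Real.cos κ ^ 2) * √(1 - r ^ 2 * Real.cos (κ + s / d n) ^ 2)) - 1))
      atTop (𝓝 0) := by
    refine squeeze_zero_norm (fun n => ?_) (by simpa using (hG.sub_const 1).abs)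
    rw [norm_mul, norm_mul]
    exact mul_le_of_le_one_left (norm_nonneg _) (mul_le_one₀ (Real.abs_sin_le_one _)
      (norm_nonneg _) (Real.abs_sin_le_one _))
  have hmain := ((Real.continuous_cos.tendsto _).comp hω).add hrem
  rw [add_zero] at hmain
  refine hmain.congr fun n => ?_
  rw [Function.comp_apply, Real.cos_sub, walkKernel]
  ring

theorem tendsto_integral_walkKernel (h0 : 0 ≤ r) (h1 : r < 1) {d : ℕ → ℕ}
    (hd : Tendsto d atTop atTop) (s : ℝ) :
    Tendsto (fun n => ∫ κ in (0 : ℝ)..2 * Real.pi, walkKernel r (d n) (s / d n) κ) atTop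
      (𝓝 (∫ κ in (0 : ℝ)..2 * Real.pi, Real.cos (s * groupVelocity r κ))) := by
  refine intervalIntegral.tendsto_integral_filter_of_dominated_convergence
    (fun _ => 1 + 2 / (1 - r ^ 2)) ?_ ?_ ?_ ?_
  · exact Eventually.of_forall fun n =>
      (continuous_walkKernel h0 h1 _ _).aestronglyMeasurable
  · exact Eventually.of_forall fun n => Eventually.of_forall fun κ _ =>
      abs_walkKernel_le h0 h1 _ _ _
  · exact intervalIntegrable_const
  · exact Eventually.of_forall fun κ _ => tendsto_walkKernel h0 h1 hd s κ

theorem periodic_walkKernel (r : ℝ) (n : ℕ) (ξ : ℝ) :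
    Function.Periodic (walkKernel r n ξ) (2 * Real.pi) := by
  intro κ
  have h : κ + 2 * Real.pi + ξ = κ + ξ + 2 * Real.pi := by ring
  simp only [walkKernel, quasiEnergy, h, Real.cos_add_two_pi, Real.sin_add_two_pi]

end

/-! ### The characteristic function as an integral of the kernel. -/

-- The coin enters only through r = |a| and the phase α of a/w. The phase merely translates k, so it
-- disappears after integration over a period.
open ComplexConjugate in
theorem exists_trace_walkSymbol_eq_walkKernel (H : Matrix.unitaryGroup (Fin 2) ℂ)
    (hb : H.1 0 1 ≠ 0) : ‖H.1 0 0‖ < 1 ∧ ∃ α : ℝ, ∀ (n : ℕ) (ξ k : ℝ), (1 / 2 : ℂ) * ∑ c, ∑ e,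
        conj ((walkSymbol H.1 k ^ n) c e) * (walkSymbol H.1 (k + ξ) ^ n) c e =
      (walkKernel ‖H.1 0 0‖ n ξ (k - α) : ℝ) := by
  obtain ⟨w, hw, hV⟩ := exists_walkSymbol_eq_smul_quaternionMatrix H
  have hrow : ‖H.1 0 0‖ ^ 2 + ‖H.1 0 1‖ ^ 2 = 1 := by
    have h := congrFun (congrFun (Matrix.mem_unitaryGroup_iff.1 H.2) 0) 0
    simp only [Matrix.mul_apply, Fin.sum_univ_two, Matrix.star_apply, RCLike.star_def,
      Matrix.one_apply_eq, Complex.mul_conj, Complex.normSq_eq_norm_sq] at h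
    exact_mod_cast h
  have h1 : ‖H.1 0 0‖ < 1 := by
    have := norm_pos_iff.2 hb
    nlinarith [norm_nonneg (H.1 0 0)]
  refine ⟨h1, Complex.arg (conj w * H.1 0 0), fun n ξ k => ?_⟩
  set r := ‖H.1 0 0‖ with hr
  have h0 : 0 ≤ r := norm_nonneg _
  set α := Complex.arg (conj w * H.1 0 0) with hα
  set b := conj w * H.1 0 1 with hbdef
  have ha : conj w * H.1 0 0 = r * Complex.exp (α * Complex.I) := by
    rw [← Complex.norm_mul_exp_arg_mul_I (conj w * H.1 0 0)]
    simp [hw, hr, hα]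
  have hbn : Complex.normSq b = 1 - r ^ 2 := by
    rw [Complex.normSq_eq_norm_sq, hbdef, norm_mul, RCLike.norm_conj, hw, one_mul]
    linarith
  have hp : ∀ k : ℝ, Complex.exp (-k * Complex.I) * (conj w * H.1 0 0) =
      ⟨r * Real.cos (k - α), -(r * Real.sin (k - α))⟩ := by
    intro k
    rw [ha, mul_left_comm, ← Complex.exp_add]
    have : (-k * Complex.I + α * Complex.I) = ((-(k - α) : ℝ) : ℂ) * Complex.I := by
      push_cast; ring
    rw [this]
    apply Complex.ext
    · simp [Complex.exp_ofReal_mul_I_re, -Complex.ofReal_neg, -Complex.ofReal_sub, -neg_sub]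
    · simp [Complex.exp_ofReal_mul_I_im, -Complex.ofReal_neg, -Complex.ofReal_sub, -neg_sub]
  have hq : ∀ k : ℝ, Complex.exp (-k * Complex.I) * b =
      ⟨Real.cos k * b.re + Real.sin k * b.im, Real.cos k * b.im - Real.sin k * b.re⟩ := by
    intro k
    have : (-k * Complex.I) = ((-k : ℝ) : ℂ) * Complex.I := by push_cast; ring
    rw [this]
    apply Complex.ext
    · simp [Complex.exp_ofReal_mul_I_re, Complex.exp_ofReal_mul_I_im, -Complex.ofReal_neg]
    · simp [Complex.exp_ofReal_mul_I_re, Complex.exp_ofReal_mul_I_im, -Complex.ofReal_neg]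
      ring
  have hpow : ∀ k : ℝ, walkSymbol H.1 k ^ n = w ^ n • quaternionMatrix
      (Real.cos (n * quasiEnergy r (k - α)) + (Real.sin (n * quasiEnergy r (k - α)) /
        Real.sin (quasiEnergy r (k - α)) * -(r * Real.sin (k - α)) : ℝ) * Complex.I)
      ((Real.sin (n * quasiEnergy r (k - α)) / Real.sin (quasiEnergy r (k - α)) : ℝ) *
        ⟨Real.cos k * b.re + Real.sin k * b.im, Real.cos k * b.im - Real.sin k * b.re⟩) := by
    intro k
    rw [hV, smul_pow, hp, hq, quaternionMatrix_pow (θ := quasiEnergy r (k - α))]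
    · rw [Complex.normSq_apply] at hbn
      rw [Complex.normSq_mk, Complex.normSq_mk]
      linear_combination r ^ 2 * Real.sin_sq_add_cos_sq (k - α) + hbn +
        (b.re * b.re + b.im * b.im) * Real.sin_sq_add_cos_sq k
    · exact cos_quasiEnergy h0 h1 _
    · rw [sin_quasiEnergy]
      exact (sqrt_one_sub_sq_mul_cos_sq_pos h0 h1 _).ne'
  have hsmul : ∀ (A B : Matrix (Fin 2) (Fin 2) ℂ) (c e : Fin 2),
      conj ((w ^ n • A) c e) * (w ^ n • B) c e = conj (A c e) * B c e := by
    intro A B c e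
    have : conj (w ^ n) * w ^ n = 1 := by
      rw [mul_comm, Complex.mul_conj, Complex.normSq_eq_norm_sq, norm_pow, hw]; simp
    simp only [Matrix.smul_apply, smul_eq_mul, map_mul]
    linear_combination (conj (A c e) * B c e) * this
  simp only [hpow, hsmul]
  rw [sum_conj_quaternionMatrix_mul, walkKernel, sin_quasiEnergy, sin_quasiEnergy,
    show k - α + ξ = k + ξ - α by ring]
  -- The off-diagonal entries contribute |b|² cos ξ with |b|² = 1 - r²; this is the second term in
  -- the numerator of `walkKernel`.
  have hξ : Real.cos ξ = Real.cos (k + ξ) * Real.cos k + Real.sin (k + ξ) * Real.sin k := by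
    rw [← Real.cos_sub]; congr 1; ring
  rw [hξ, ← hbn, Complex.normSq_apply]
  congr 1
  have e1 := (sqrt_one_sub_sq_mul_cos_sq_pos h0 h1 (k - α)).ne'
  have e2 := (sqrt_one_sub_sq_mul_cos_sq_pos h0 h1 (k + ξ - α)).ne'
  generalize √(1 - r ^ 2 * Real.cos (k - α) ^ 2) = D at *
  generalize √(1 - r ^ 2 * Real.cos (k + ξ - α) ^ 2) = D' at *
  generalize Real.sin (n * quasiEnergy r (k - α)) = S at *
  generalize Real.sin (n * quasiEnergy r (k + ξ - α)) = S' at *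
  generalize Real.cos (n * quasiEnergy r (k - α)) = C at *
  generalize Real.cos (n * quasiEnergy r (k + ξ - α)) = C' at *
  generalize Real.sin (k - α) = y at *
  generalize Real.sin (k + ξ - α) = y' at *
  simp
  field_simp
  ring

theorem sum_walkProb_mul_exp (H : Matrix.unitaryGroup (Fin 2) ℂ) (hb : H.1 0 1 ≠ 0) (n : ℕ)
    (ξ : ℝ) :
    ∑ x ∈ Finset.Icc (-n : ℤ) n, (walkProb H n x : ℂ) * Complex.exp (ξ * x * Complex.I) =
      (((1 / (2 * Real.pi)) * ∫ κ in (0 : ℝ)..2 * Real.pi,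
        walkKernel ‖H.1 0 0‖ n ξ κ : ℝ) : ℂ) := by
  obtain ⟨h1, α, hα⟩ := exists_trace_walkSymbol_eq_walkKernel H hb
  rw [sum_walkProb_mul_exp_eq_integral]
  simp only [hα]
  rw [intervalIntegral.integral_ofReal]
  rw [intervalIntegral.integral_comp_sub_right (walkKernel ‖H.1 0 0‖ n ξ),
    show 2 * Real.pi - α = (0 - α) + 2 * Real.pi by ring,
    (periodic_walkKernel ‖H.1 0 0‖ n ξ).intervalIntegral_add_eq (0 - α) 0, zero_add]
  push_cast
  rfl

/-! ### K(r) as the law of the group velocity. -/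

section

variable {r : ℝ}

theorem hasDerivAt_groupVelocity (h0 : 0 ≤ r) (h1 : r < 1) (κ : ℝ) :
    HasDerivAt (groupVelocity r) (r * Real.cos κ * (1 - r ^ 2) /
      ((1 - r ^ 2 * Real.cos κ ^ 2) * √(1 - r ^ 2 * Real.cos κ ^ 2))) κ := by
  have hpos := one_sub_sq_mul_cos_sq_pos h0 h1 κ
  have hspos := sqrt_one_sub_sq_mul_cos_sq_pos h0 h1 κ
  have hD : HasDerivAt (fun κ => 1 - r ^ 2 * Real.cos κ ^ 2)
      (2 * r ^ 2 * Real.cos κ * Real.sin κ) κ := by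
    convert! (((Real.hasDerivAt_cos κ).pow 2).const_mul (r ^ 2)).const_sub 1 using 1
    push_cast
    ring
  convert! ((Real.hasDerivAt_sin κ).const_mul r).div (hD.sqrt hpos.ne') hspos.ne' using 1
  rw [Real.sq_sqrt hpos.le]
  have hsq := Real.sq_sqrt hpos.le
  field_simp
  rw [hsq]
  linear_combination (r ^ 3 * Real.cos κ) * Real.sin_sq_add_cos_sq κ

theorem strictMonoOn_groupVelocity (h0 : 0 < r) (h1 : r < 1) :
    StrictMonoOn (groupVelocity r) (Set.Icc (-(Real.pi / 2)) (Real.pi / 2)) := by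
  refine strictMonoOn_of_deriv_pos (convex_Icc _ _)
    (continuous_groupVelocity h0.le h1).continuousOn fun κ hκ => ?_
  rw [interior_Icc] at hκ
  rw [(hasDerivAt_groupVelocity h0.le h1 κ).deriv]
  have := Real.cos_pos_of_mem_Ioo hκ
  have := one_sub_sq_pos h0.le h1
  have := one_sub_sq_mul_cos_sq_pos h0.le h1 κ
  positivity

theorem groupVelocity_neg (r κ : ℝ) : groupVelocity r (-κ) = -groupVelocity r κ := by
  simp [groupVelocity, neg_div]

theorem groupVelocity_add_pi (r κ : ℝ) : groupVelocity r (κ + Real.pi) = -groupVelocity r κ := by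
  simp [groupVelocity, neg_div]

theorem image_groupVelocity_Ioo (h0 : 0 < r) (h1 : r < 1) :
    groupVelocity r '' Set.Ioo (-(Real.pi / 2)) (Real.pi / 2) = Set.Ioo (-r) r := by
  have hend : groupVelocity r (Real.pi / 2) = r := by simp [groupVelocity]
  have hpi := Real.pi_pos
  refine Set.Subset.antisymm ?_ ?_
  · rintro _ ⟨κ, hκ, rfl⟩
    have hmono := strictMonoOn_groupVelocity h0 h1
    have hl := hmono (Set.left_mem_Icc.2 (by linarith)) (Set.Ioo_subset_Icc_self hκ) hκ.1
    have hr := hmono (Set.Ioo_subset_Icc_self hκ) (Set.right_mem_Icc.2 (by linarith)) hκ.2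
    rw [groupVelocity_neg, hend] at hl
    rw [hend] at hr
    exact ⟨hl, hr⟩
  · have := intermediate_value_Ioo (a := -(Real.pi / 2)) (b := Real.pi / 2) (by linarith)
      (continuous_groupVelocity h0.le h1).continuousOn
    rwa [groupVelocity_neg, hend] at this

/-- The Jacobian identity behind K(r): in the variable κ its density becomes the constant 1/π. -/
theorem deriv_groupVelocity_mul_konnoDensity (h0 : 0 < r) (h1 : r < 1) {κ : ℝ}
    (hκ : κ ∈ Set.Ioo (-(Real.pi / 2)) (Real.pi / 2)) :
    r * Real.cos κ * (1 - r ^ 2) /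
      ((1 - r ^ 2 * Real.cos κ ^ 2) * √(1 - r ^ 2 * Real.cos κ ^ 2)) *
      konnoDensity r (groupVelocity r κ) = 1 / Real.pi := by
  have hmem : groupVelocity r κ ∈ Set.Ioo (-r) r :=
    image_groupVelocity_Ioo h0 h1 ▸ Set.mem_image_of_mem _ hκ
  have hcos := Real.cos_pos_of_mem_Ioo hκ
  have hr := one_sub_sq_pos h0.le h1
  have hD := one_sub_sq_mul_cos_sq_pos h0.le h1 κ
  have hE := Real.sqrt_pos.2 hr
  have hsq : groupVelocity r κ ^ 2 = r ^ 2 * Real.sin κ ^ 2 / (1 - r ^ 2 * Real.cos κ ^ 2) := by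
    rw [groupVelocity, div_pow, Real.sq_sqrt hD.le, mul_pow]
  have e1 : 1 - groupVelocity r κ ^ 2 = (1 - r ^ 2) / (1 - r ^ 2 * Real.cos κ ^ 2) := by
    rw [hsq, Real.sin_sq]
    field_simp
    ring
  have e2 : √(r ^ 2 - groupVelocity r κ ^ 2) =
      r * Real.cos κ * √(1 - r ^ 2) / √(1 - r ^ 2 * Real.cos κ ^ 2) := by
    rw [Real.sqrt_eq_iff_mul_self_eq_of_pos (by positivity), hsq, Real.sin_sq,
      ← sq, div_pow, mul_pow, Real.sq_sqrt hr.le, Real.sq_sqrt hD.le]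
    field_simp
    ring
  rw [konnoDensity, Set.indicator_of_mem hmem, e1, e2]
  have := Real.pi_pos
  have hsD := Real.sqrt_pos.2 hD
  field_simp

theorem konnoLaw_eq_smul_map (h0 : 0 < r) (h1 : r < 1) :
    konnoLaw r = ENNReal.ofReal (1 / Real.pi) •
      (volume.restrict (Set.Ioo (-(Real.pi / 2)) (Real.pi / 2))).map (groupVelocity r) := by
  have hmeas : Measurable (groupVelocity r) := (continuous_groupVelocity h0.le h1).measurable
  ext A hA
  rw [konnoLaw, withDensity_apply _ hA, Measure.smul_apply, Measure.map_apply hmeas hA,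
    Measure.restrict_apply (hmeas hA), ← lintegral_indicator hA]
  have hsupp : ∫⁻ x, A.indicator (fun x => ENNReal.ofReal (konnoDensity r x)) x =
      ∫⁻ x in Set.Ioo (-r) r, A.indicator (fun x => ENNReal.ofReal (konnoDensity r x)) x := by
    rw [← lintegral_indicator measurableSet_Ioo]
    congr 1
    ext x
    by_cases hx : x ∈ Set.Ioo (-r) r
    · rw [Set.indicator_of_mem hx]
    · rw [Set.indicator_of_notMem hx]
      by_cases hxA : x ∈ A <;> simp [hxA, konnoDensity, Set.indicator_of_notMem hx]
  rw [hsupp, ← image_groupVelocity_Ioo h0 h1, lintegral_image_eq_lintegral_abs_deriv_mul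
    measurableSet_Ioo (fun κ _ => (hasDerivAt_groupVelocity h0.le h1 κ).hasDerivWithinAt)
    ((strictMonoOn_groupVelocity h0 h1).mono Set.Ioo_subset_Icc_self).injOn]
  have hint : ∀ κ ∈ Set.Ioo (-(Real.pi / 2)) (Real.pi / 2),
      ENNReal.ofReal |r * Real.cos κ * (1 - r ^ 2) /
        ((1 - r ^ 2 * Real.cos κ ^ 2) * √(1 - r ^ 2 * Real.cos κ ^ 2))| *
        A.indicator (fun x => ENNReal.ofReal (konnoDensity r x)) (groupVelocity r κ) =
      (groupVelocity r ⁻¹' A).indicator (fun _ => ENNReal.ofReal (1 / Real.pi)) κ := by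
    intro κ hκ
    by_cases hA : groupVelocity r κ ∈ A
    · rw [Set.indicator_of_mem hA, Set.indicator_of_mem (Set.mem_preimage.2 hA), abs_of_nonneg,
        ← ENNReal.ofReal_mul, deriv_groupVelocity_mul_konnoDensity h0 h1 hκ]
      all_goals
        have := Real.cos_pos_of_mem_Ioo hκ
        have := one_sub_sq_pos h0.le h1
        have := one_sub_sq_mul_cos_sq_pos h0.le h1 κ
        positivity
    · rw [Set.indicator_of_notMem hA, Set.indicator_of_notMem (by simpa using hA), mul_zero]
  rw [setLIntegral_congr_fun measurableSet_Ioo hint, lintegral_indicator (hmeas hA),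
    setLIntegral_const, Measure.restrict_apply (hmeas hA), smul_eq_mul]

theorem isProbabilityMeasure_konnoLaw (h0 : 0 < r) (h1 : r < 1) :
    IsProbabilityMeasure (konnoLaw r) := by
  refine ⟨?_⟩
  have hmeas : Measurable (groupVelocity r) := (continuous_groupVelocity h0.le h1).measurable
  rw [konnoLaw_eq_smul_map h0 h1, Measure.smul_apply, Measure.map_apply hmeas MeasurableSet.univ,
    Set.preimage_univ, Measure.restrict_apply_univ, Real.volume_Ioo, smul_eq_mul,
    ← ENNReal.ofReal_mul (by positivity)]
  have : 1 / Real.pi * (Real.pi / 2 - -(Real.pi / 2)) = 1 := by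
    field_simp
    ring
  rw [this, ENNReal.ofReal_one]

/-- A full period covers the velocity range twice: ω' changes sign under κ ↦ κ + π and cosine is
even. The half period is the one on which ω' is injective. -/
theorem integral_cos_mul_groupVelocity (h0 : 0 ≤ r) (h1 : r < 1) (s : ℝ) :
    ∫ κ in (0 : ℝ)..2 * Real.pi, Real.cos (s * groupVelocity r κ) =
      2 * ∫ κ in -(Real.pi / 2)..Real.pi / 2, Real.cos (s * groupVelocity r κ) := by
  have hper : Function.Periodic (fun κ => Real.cos (s * groupVelocity r κ)) Real.pi := by
    intro κ
    simp only [groupVelocity_add_pi, mul_neg, Real.cos_neg]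
  have hcont := continuous_groupVelocity h0 h1
  have h := hper.intervalIntegral_add_eq_add 0 Real.pi
    (fun a b => Continuous.intervalIntegrable (by fun_prop) a b)
  have h2 := hper.intervalIntegral_add_eq 0 (-(Real.pi / 2))
  rw [zero_add, show -(Real.pi / 2) + Real.pi = Real.pi / 2 by ring] at h2
  rw [zero_add, ← two_mul] at h
  rw [h, h2, two_mul]

theorem charFun_konnoLaw (h0 : 0 < r) (h1 : r < 1) (s : ℝ) :
    charFun (konnoLaw r) s = ((1 / (2 * Real.pi) * ∫ κ in (0 : ℝ)..2 * Real.pi,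
      Real.cos (s * groupVelocity r κ) : ℝ) : ℂ) := by
  have hcont := continuous_groupVelocity h0.le h1
  have hpi := Real.pi_pos
  rw [charFun_apply_real, konnoLaw_eq_smul_map h0 h1, integral_smul_measure,
    integral_map hcont.aemeasurable (by fun_prop), ← integral_Ioc_eq_integral_Ioo,
    ← intervalIntegral.integral_of_le (by linarith), integral_cos_mul_groupVelocity h0.le h1]
  -- The velocity is odd in κ, which kills the imaginary part.
  have hsin : ∫ κ in -(Real.pi / 2)..Real.pi / 2, Real.sin (s * groupVelocity r κ) = 0 := by
    have h := intervalIntegral.integral_comp_neg (a := -(Real.pi / 2)) (b := Real.pi / 2)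
      fun κ => Real.sin (s * groupVelocity r κ)
    simp only [groupVelocity_neg, mul_neg, Real.sin_neg, intervalIntegral.integral_neg,
      neg_neg] at h
    linarith
  have hexp : ∀ κ, Complex.exp (s * groupVelocity r κ * Complex.I) =
      (Real.cos (s * groupVelocity r κ) : ℂ) + (Real.sin (s * groupVelocity r κ) : ℂ) *
        Complex.I := by
    intro κ
    rw [Complex.exp_mul_I]
    push_cast
    rfl
  simp only [hexp]
  rw [intervalIntegral.integral_add
    (Continuous.intervalIntegrable (by fun_prop) _ _)
    (Continuous.intervalIntegrable (by fun_prop) _ _), intervalIntegral.integral_mul_const,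
    intervalIntegral.integral_ofReal, intervalIntegral.integral_ofReal, hsin,
    ENNReal.toReal_ofReal (by positivity), Complex.real_smul]
  push_cast
  field_simp
  ring

/-! ### The second moment of the group velocity. -/

/-- The usual antiderivative arctan(tan κ / e) jumps at odd multiples of π/2. Subtracting κ by the
addition formula for arctan gives the fraction used here, which is smooth on all of ℝ, so the
fundamental theorem applies on the whole period. -/
theorem hasDerivAt_arctan_antiderivative {e : ℝ} (he : 0 < e) (κ : ℝ) :
    HasDerivAt (fun κ => κ + Real.arctan ((1 - e) * (Real.sin κ * Real.cos κ) /
      (e * Real.cos κ ^ 2 + Real.sin κ ^ 2)))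
      (e / (1 - (1 - e ^ 2) * Real.cos κ ^ 2)) κ := by
  have hsc := Real.sin_sq_add_cos_sq κ
  have hE : 0 < e * Real.cos κ ^ 2 + Real.sin κ ^ 2 := by
    rcases eq_or_ne (Real.sin κ) 0 with h | h
    · rw [h] at hsc ⊢
      nlinarith
    · positivity
  have hN : HasDerivAt (fun κ => (1 - e) * (Real.sin κ * Real.cos κ))
      ((1 - e) * (Real.cos κ ^ 2 - Real.sin κ ^ 2)) κ := by
    convert! ((Real.hasDerivAt_sin κ).mul (Real.hasDerivAt_cos κ)).const_mul (1 - e) using 1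
    ring
  have hD : HasDerivAt (fun κ => e * Real.cos κ ^ 2 + Real.sin κ ^ 2)
      (2 * (1 - e) * (Real.sin κ * Real.cos κ)) κ := by
    convert! (((Real.hasDerivAt_cos κ).pow 2).const_mul e).add
      ((Real.hasDerivAt_sin κ).pow 2) using 1
    push_cast
    ring
  convert! (hasDerivAt_id κ).add ((hN.div hD hE.ne').arctan) using 1
  have hc : Real.cos κ ^ 2 = 1 - Real.sin κ ^ 2 := by linarith
  have hden : (e * Real.cos κ ^ 2 + Real.sin κ ^ 2) ^ 2 +
      ((1 - e) * (Real.sin κ * Real.cos κ)) ^ 2 = 1 - (1 - e ^ 2) * Real.cos κ ^ 2 := by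
    rw [mul_pow, mul_pow, hc]; ring
  have hden_pos : 0 < 1 - (1 - e ^ 2) * Real.cos κ ^ 2 := by
    rw [← hden]; positivity
  have hrw : 1 + ((1 - e) * (Real.sin κ * Real.cos κ) /
      (e * Real.cos κ ^ 2 + Real.sin κ ^ 2)) ^ 2 = (1 - (1 - e ^ 2) * Real.cos κ ^ 2) /
      (e * Real.cos κ ^ 2 + Real.sin κ ^ 2) ^ 2 := by
    rw [← hden]; field_simp
  rw [Pi.div_apply, hrw]
  have hnum : 1 - (1 - e ^ 2) * Real.cos κ ^ 2 +
      ((1 - e) * (Real.cos κ ^ 2 - Real.sin κ ^ 2) * (e * Real.cos κ ^ 2 + Real.sin κ ^ 2) -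
        (1 - e) * (Real.sin κ * Real.cos κ) * (2 * (1 - e) * (Real.sin κ * Real.cos κ))) = e := by
    have : (1 - e) * (Real.sin κ * Real.cos κ) * (2 * (1 - e) * (Real.sin κ * Real.cos κ)) =
        2 * (1 - e) ^ 2 * (Real.sin κ ^ 2 * Real.cos κ ^ 2) := by ring
    rw [this, hc]
    ring
  generalize 1 - (1 - e ^ 2) * Real.cos κ ^ 2 = D at *
  generalize (1 - e) * (Real.cos κ ^ 2 - Real.sin κ ^ 2) * (e * Real.cos κ ^ 2 + Real.sin κ ^ 2) -
    (1 - e) * (Real.sin κ * Real.cos κ) * (2 * (1 - e) * (Real.sin κ * Real.cos κ)) = N at *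
  field_simp
  linarith

/-- With e = √(1-r²), ω'² = 1 - e · e/(1 - r² cos² κ). The arctan term vanishes at both ends of the
period, so the last fraction integrates to 2π. -/
theorem integral_groupVelocity_sq (h0 : 0 ≤ r) (h1 : r < 1) :
    ∫ κ in (0 : ℝ)..2 * Real.pi, groupVelocity r κ ^ 2 = 2 * Real.pi * (1 - √(1 - r ^ 2)) := by
  have hr := one_sub_sq_pos h0 h1
  set e := √(1 - r ^ 2) with he
  have he0 : 0 < e := Real.sqrt_pos.2 hr
  have he2 : r ^ 2 = 1 - e ^ 2 := by rw [he, Real.sq_sqrt hr.le]; ring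
  have hsq : ∀ κ, groupVelocity r κ ^ 2 = 1 - e * (e / (1 - (1 - e ^ 2) * Real.cos κ ^ 2)) := by
    intro κ
    have hD := one_sub_sq_mul_cos_sq_pos h0 h1 κ
    rw [groupVelocity, div_pow, Real.sq_sqrt hD.le, mul_pow, Real.sin_sq]
    rw [he2] at hD ⊢
    field_simp
    ring
  have hcont : Continuous fun κ => e / (1 - (1 - e ^ 2) * Real.cos κ ^ 2) := by
    refine Continuous.div (by fun_prop) (by fun_prop) fun κ => ?_
    rw [← he2]
    exact (one_sub_sq_mul_cos_sq_pos h0 h1 κ).ne'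
  have hftc := intervalIntegral.integral_eq_sub_of_hasDerivAt (a := 0) (b := 2 * Real.pi)
    (fun κ _ => hasDerivAt_arctan_antiderivative he0 κ) (hcont.intervalIntegrable _ _)
  simp only [hsq]
  rw [intervalIntegral.integral_sub intervalIntegrable_const
    ((hcont.const_mul e).intervalIntegrable _ _), intervalIntegral.integral_const_mul, hftc]
  simp
  ring

theorem abs_groupVelocity_le_one (h0 : 0 ≤ r) (h1 : r < 1) (κ : ℝ) :
    |groupVelocity r κ| ≤ 1 := by
  have hD := one_sub_sq_mul_cos_sq_pos h0 h1 κ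
  rw [← sq_le_one_iff_abs_le_one, groupVelocity, div_pow, Real.sq_sqrt hD.le, mul_pow,
    div_le_one hD, Real.sin_sq]
  nlinarith
end

/-! ### Expansions of the characteristic function, and second moments. -/

theorem tendsto_one_sub_pow_exp {x : ℕ → ℝ} {M : ℕ → ℕ} {c : ℝ} (hx : Tendsto x atTop (𝓝 0))
    (hM : Tendsto (fun n => M n * x n) atTop (𝓝 c)) :
    Tendsto (fun n => (1 - x n) ^ M n) atTop (𝓝 (Real.exp (-c))) := by
  have hlog : Tendsto (fun n => M n * (x n + Real.log (1 - x n))) atTop (𝓝 0) := by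
    have hbound : Tendsto (fun n => |M n * x n| * (|x n| * 2)) atTop (𝓝 0) := by
      simpa using hM.abs.mul (hx.abs.mul_const 2)
    refine squeeze_zero_norm' ?_ hbound
    filter_upwards [hx.abs.eventually_lt_const (show |(0 : ℝ)| < 1 / 2 by norm_num)] with n hn
    -- One term of the logarithm series: |x + log(1-x)| ≤ x²/(1-|x|) ≤ 2x² when |x| < 1/2.
    have h := Real.abs_log_sub_add_sum_range_le (x := x n) (by linarith) 1
    simp only [Finset.sum_range_one, Nat.cast_zero, zero_add, pow_one, div_one,
      Nat.reduceAdd] at h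
    rw [norm_mul, Real.norm_eq_abs, Real.norm_eq_abs, abs_mul, mul_assoc]
    refine mul_le_mul_of_nonneg_left (h.trans ?_) (abs_nonneg _)
    rw [div_le_iff₀ (by linarith)]
    nlinarith [sq_nonneg |x n|]
  have h := (Real.continuous_exp.tendsto _).comp (hlog.sub hM)
  rw [zero_sub] at h
  refine h.congr' ?_
  filter_upwards [hx.eventually_lt_const (show (0 : ℝ) < 1 by norm_num)] with n hn
  rw [Function.comp_apply, ← mul_sub, add_sub_cancel_left, Real.exp_nat_mul,
    Real.exp_log (by linarith)]

theorem abs_cos_sub_le {x : ℝ} (hx : |x| ≤ 1) : |Real.cos x - (1 - x ^ 2 / 2)| ≤ x ^ 4 := by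
  refine (Real.cos_bound hx).trans ?_
  rw [pow_abs, abs_of_nonneg (by positivity)]
  nlinarith [show 0 ≤ x ^ 4 by positivity]

/-- The characteristic function of the walk, `E cos(ξ X)` for `X` the position after `n` steps. -/
noncomputable def walkCharFun (H : Matrix.unitaryGroup (Fin 2) ℂ) (n : ℕ) (ξ : ℝ) : ℝ :=
  ∑ x ∈ Finset.Icc (-n : ℤ) n, walkProb H n x * Real.cos (ξ * x)

/-- The second moment of the position after `n` steps. -/
noncomputable def walkSecondMoment (H : Matrix.unitaryGroup (Fin 2) ℂ) (n : ℕ) : ℝ :=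
  ∑ x ∈ Finset.Icc (-n : ℤ) n, walkProb H n x * (x : ℝ) ^ 2

section

variable (H : Matrix.unitaryGroup (Fin 2) ℂ)

theorem walkProb_nonneg (n : ℕ) (x : ℤ) : 0 ≤ walkProb H n x := by
  rw [walkProb_eq_sum_amplitude]
  positivity

theorem walkProb_eq_zero (n : ℕ) {x : ℤ} (hx : x ∉ Finset.Icc (-n : ℤ) n) :
    walkProb H n x = 0 := by
  rw [Finset.mem_Icc, ← abs_le, not_le] at hx
  simp [walkProb_eq_sum_amplitude, amplitude_eq_zero H n x _ _ hx]

variable {H}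

theorem sum_walkProb_mul_exp_eq_walkCharFun (hb : H.1 0 1 ≠ 0) (n : ℕ) (ξ : ℝ) :
    ∑ x ∈ Finset.Icc (-n : ℤ) n, (walkProb H n x : ℂ) * Complex.exp (ξ * x * Complex.I) =
      walkCharFun H n ξ := by
  have h := sum_walkProb_mul_exp H hb n ξ
  rw [h]
  congr 1
  rw [← Complex.ofReal_re (1 / _ * _), ← h, walkCharFun, Complex.re_sum]
  refine Finset.sum_congr rfl fun x _ => ?_
  rw [Complex.re_ofReal_mul, ← Complex.exp_ofReal_mul_I_re]
  push_cast
  rfl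

theorem walkCharFun_eq_integral (hb : H.1 0 1 ≠ 0) (n : ℕ) (ξ : ℝ) :
    walkCharFun H n ξ = 1 / (2 * Real.pi) * ∫ κ in (0 : ℝ)..2 * Real.pi,
      walkKernel ‖H.1 0 0‖ n ξ κ := by
  have h := sum_walkProb_mul_exp H hb n ξ
  rw [sum_walkProb_mul_exp_eq_walkCharFun hb] at h
  exact_mod_cast h

/-- Total mass is the characteristic function at ξ = 0, where the kernel is identically 1. -/
theorem sum_walkProb (hb : H.1 0 1 ≠ 0) (n : ℕ) :
    ∑ x ∈ Finset.Icc (-n : ℤ) n, walkProb H n x = 1 := by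
  have h1 := (exists_trace_walkSymbol_eq_walkKernel H hb).1
  have h := walkCharFun_eq_integral hb n 0
  have hker : ∀ κ, walkKernel ‖H.1 0 0‖ n 0 κ = 1 := by
    intro κ
    have hpos := one_sub_sq_mul_cos_sq_pos (norm_nonneg _) h1 κ
    have hnum : ‖H.1 0 0‖ ^ 2 * Real.sin κ * Real.sin κ + (1 - ‖H.1 0 0‖ ^ 2) =
        1 - ‖H.1 0 0‖ ^ 2 * Real.cos κ ^ 2 := by
      linear_combination ‖H.1 0 0‖ ^ 2 * Real.sin_sq_add_cos_sq κ
    rw [walkKernel, add_zero, Real.mul_self_sqrt hpos.le, Real.cos_zero, mul_one, hnum,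
      div_self hpos.ne']
    linear_combination Real.sin_sq_add_cos_sq (n * quasiEnergy ‖H.1 0 0‖ κ)
  simp only [walkCharFun, zero_mul, Real.cos_zero, mul_one, hker] at h
  rw [h, intervalIntegral.integral_const]
  have := Real.pi_ne_zero
  simp
  field_simp

/-- The light cone |x| ≤ n makes the quartic Taylor error of cosine uniform in n as a function of
ξn, so no separate fourth-moment estimate is needed. -/
theorem abs_walkCharFun_sub_le (hb : H.1 0 1 ≠ 0) {n : ℕ} {ξ : ℝ} (hξ : |ξ| * n ≤ 1) :
    |walkCharFun H n ξ - (1 - ξ ^ 2 * walkSecondMoment H n / 2)| ≤ (ξ * n) ^ 4 := by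
  have hsum : walkCharFun H n ξ - (1 - ξ ^ 2 * walkSecondMoment H n / 2) =
      ∑ x ∈ Finset.Icc (-n : ℤ) n, walkProb H n x *
        (Real.cos (ξ * x) - (1 - (ξ * x) ^ 2 / 2)) := by
    have h : 1 - ξ ^ 2 * walkSecondMoment H n / 2 =
        ∑ x ∈ Finset.Icc (-n : ℤ) n, walkProb H n x * (1 - (ξ * x) ^ 2 / 2) := by
      simp only [mul_sub, mul_one, Finset.sum_sub_distrib, sum_walkProb hb]
      rw [walkSecondMoment, Finset.mul_sum, Finset.sum_div]
      congr 1
      exact Finset.sum_congr rfl fun x _ => by ring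
    rw [h, walkCharFun, ← Finset.sum_sub_distrib]
    exact Finset.sum_congr rfl fun x _ => by ring
  rw [hsum]
  refine (Finset.abs_sum_le_sum_abs _ _).trans ?_
  have hone : ∑ x ∈ Finset.Icc (-n : ℤ) n, walkProb H n x * (ξ * n) ^ 4 = (ξ * n) ^ 4 := by
    rw [← Finset.sum_mul, sum_walkProb hb, one_mul]
  rw [← hone]
  refine Finset.sum_le_sum fun x hx => ?_
  rw [abs_mul, abs_of_nonneg (walkProb_nonneg H n x)]
  refine mul_le_mul_of_nonneg_left ?_ (walkProb_nonneg H n x)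
  have hxn : |(x : ℝ)| ≤ n := by
    rw [Finset.mem_Icc, ← abs_le] at hx
    exact_mod_cast hx
  have h2 : |ξ * x| ≤ |ξ| * n := by
    rw [abs_mul]
    gcongr
  refine (abs_cos_sub_le (h2.trans hξ)).trans ?_
  rw [← Even.pow_abs (by decide) (ξ * x), ← Even.pow_abs (by decide) (ξ * n), abs_mul ξ n,
    Nat.abs_cast]
  gcongr

theorem tendsto_walkCharFun (hb : H.1 0 1 ≠ 0) {d : ℕ → ℕ} (hd : Tendsto d atTop atTop) (s : ℝ) :
    Tendsto (fun n => walkCharFun H (d n) (s / d n)) atTop (𝓝 (1 / (2 * Real.pi) *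
      ∫ κ in (0 : ℝ)..2 * Real.pi, Real.cos (s * groupVelocity ‖H.1 0 0‖ κ))) := by
  simp only [walkCharFun_eq_integral hb]
  exact (tendsto_integral_walkKernel (norm_nonneg _)
    (exists_trace_walkSymbol_eq_walkKernel H hb).1 hd s).const_mul _

theorem abs_integral_cos_groupVelocity_sub_le {r : ℝ} (h0 : 0 ≤ r) (h1 : r < 1) {s : ℝ}
    (hs : |s| ≤ 1) :
    |1 / (2 * Real.pi) * (∫ κ in (0 : ℝ)..2 * Real.pi, Real.cos (s * groupVelocity r κ)) -
      (1 - s ^ 2 * (1 - √(1 - r ^ 2)) / 2)| ≤ s ^ 4 := by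
  have hcont := continuous_groupVelocity h0 h1
  have hpi := Real.pi_pos
  have hint : ∫ κ in (0 : ℝ)..2 * Real.pi, (Real.cos (s * groupVelocity r κ) -
      (1 - (s * groupVelocity r κ) ^ 2 / 2)) =
      (∫ κ in (0 : ℝ)..2 * Real.pi, Real.cos (s * groupVelocity r κ)) -
        2 * Real.pi * (1 - s ^ 2 * (1 - √(1 - r ^ 2)) / 2) := by
    have hsq : ∀ κ, (s * groupVelocity r κ) ^ 2 / 2 = s ^ 2 / 2 * groupVelocity r κ ^ 2 :=
      fun κ => by ring
    simp only [hsq]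
    rw [intervalIntegral.integral_sub (Continuous.intervalIntegrable (by fun_prop) _ _)
      (Continuous.intervalIntegrable (by fun_prop) _ _), intervalIntegral.integral_sub
      (Continuous.intervalIntegrable (by fun_prop) _ _)
      (Continuous.intervalIntegrable (by fun_prop) _ _), intervalIntegral.integral_const_mul,
      integral_groupVelocity_sq h0 h1, intervalIntegral.integral_const, smul_eq_mul]
    ring
  have hle := intervalIntegral.norm_integral_le_of_norm_le_const (a := 0) (b := 2 * Real.pi)
    (C := s ^ 4) (f := fun κ => Real.cos (s * groupVelocity r κ) -
      (1 - (s * groupVelocity r κ) ^ 2 / 2)) fun κ _ => by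
    have hv := abs_groupVelocity_le_one h0 h1 κ
    have h2 : |s * groupVelocity r κ| ≤ |s| := by
      rw [abs_mul]
      exact mul_le_of_le_one_right (abs_nonneg _) hv
    refine (abs_cos_sub_le (h2.trans hs)).trans ?_
    rw [← Even.pow_abs (by decide) (s * _), ← Even.pow_abs (by decide) s]
    gcongr
  rw [hint, sub_zero, abs_of_pos (by positivity), Real.norm_eq_abs] at hle
  have hrw : ∀ I c : ℝ, 1 / (2 * Real.pi) * I - c = (I - 2 * Real.pi * c) / (2 * Real.pi) := by
    intro I c
    field_simp
  rw [hrw, abs_div, abs_of_pos (show 0 < 2 * Real.pi by positivity), div_le_iff₀ (by positivity)]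
  exact hle

/-- Both φ_d(s/d) and its limit have a quadratic expansion at s with error at most s⁴. Comparing
them at one small fixed s and dividing by s² transfers convergence to the quadratic coefficients. -/
theorem tendsto_walkSecondMoment_div_sq (hb : H.1 0 1 ≠ 0) {d : ℕ → ℕ}
    (hd : Tendsto d atTop atTop) :
    Tendsto (fun n => walkSecondMoment H (d n) / (d n : ℝ) ^ 2) atTop
      (𝓝 (1 - √(1 - ‖H.1 0 0‖ ^ 2))) := by
  have h1 := (exists_trace_walkSymbol_eq_walkKernel H hb).1
  rw [Metric.tendsto_nhds]
  intro ε hε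
  -- The comparison gives |m - v| < 4s² + ε/4, where s² ≤ s ≤ ε/16.
  set s := min 1 (ε / 16) with hsdef
  have hs0 : 0 < s := lt_min one_pos (by positivity)
  have hs1 : s ≤ 1 := min_le_left _ _
  have hsε : s ≤ ε / 16 := min_le_right _ _
  have hψ := abs_integral_cos_groupVelocity_sub_le (norm_nonneg (H.1 0 0)) h1
    (show |s| ≤ 1 by rwa [abs_of_pos hs0])
  filter_upwards [Metric.tendsto_nhds.1 (tendsto_walkCharFun hb hd s) (s ^ 2 * ε / 8)
    (by positivity), hd.eventually_gt_atTop 0] with n hn hdn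
  have hdn' : (0 : ℝ) < d n := by exact_mod_cast hdn
  have hφ := abs_walkCharFun_sub_le hb (n := d n) (ξ := s / d n) (by
    rw [abs_of_pos (by positivity), div_mul_cancel₀ _ hdn'.ne']
    exact hs1)
  rw [div_mul_cancel₀ _ hdn'.ne', div_pow, div_mul_eq_mul_div, mul_div_assoc] at hφ
  rw [Real.dist_eq] at hn ⊢
  generalize 1 / (2 * Real.pi) * (∫ κ in (0 : ℝ)..2 * Real.pi,
    Real.cos (s * groupVelocity ‖H.1 0 0‖ κ)) = ψ at *
  generalize walkCharFun H (d n) (s / d n) = φ at *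
  generalize walkSecondMoment H (d n) / (d n : ℝ) ^ 2 = m at *
  generalize 1 - √(1 - ‖H.1 0 0‖ ^ 2) = v at *
  rw [abs_le] at hφ hψ
  rw [abs_lt] at hn ⊢
  have hs2 : 0 < s ^ 2 := by positivity
  have hs4 : s ^ 4 ≤ s ^ 2 * (ε / 16) := by
    have : s ^ 4 = s ^ 2 * (s * s) := by ring
    rw [this]
    gcongr
    nlinarith
  constructor
  · refine lt_of_mul_lt_mul_left ?_ hs2.le
    nlinarith
  · refine lt_of_mul_lt_mul_left ?_ hs2.le
    nlinarith

theorem walkSecondMoment_one (hb : H.1 0 1 ≠ 0) : walkSecondMoment H 1 = 1 := by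
  have h0 : walkProb H 1 0 = 0 := by
    rw [walkProb_eq_sum_amplitude]
    simp only [amplitude_succ, amplitude_zero]
    simp [displacement]
  have hI : Finset.Icc (-(1 : ℕ) : ℤ) (1 : ℕ) = {-1, 0, 1} := by decide
  have h := sum_walkProb hb 1
  rw [hI] at h
  rw [walkSecondMoment, hI]
  simp [h0] at h ⊢
  exact h

end

/-! ### Limits of the powers, and convergence in distribution. -/

theorem charFun_map_of_walkProb {Ω : Type*} [MeasurableSpace Ω] {P : Measure Ω}
    [IsProbabilityMeasure P] {H : Matrix.unitaryGroup (Fin 2) ℂ} (hb : H.1 0 1 ≠ 0) {n : ℕ}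
    {Y : Ω → ℤ} (hY : Measurable Y) (hlaw : ∀ x, P.real {ω | Y ω = x} = walkProb H n x) (ξ : ℝ) :
    charFun (P.map fun ω => (Y ω : ℝ)) ξ = walkCharFun H n ξ := by
  have hmap : (P.map fun ω => (Y ω : ℝ)) = (P.map Y).map (fun x : ℤ => (x : ℝ)) := by
    rw [Measure.map_map (by fun_prop) hY]
    rfl
  have := Measure.isProbabilityMeasure_map (μ := P) hY.aemeasurable
  rw [hmap, charFun_apply_real, integral_map (by fun_prop) (by fun_prop), integral_countable]
  · have hreal : ∀ x, (P.map Y).real {x} = walkProb H n x := fun x => by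
      rw [map_measureReal_apply hY (measurableSet_singleton x), ← hlaw]
      rfl
    simp only [hreal, Complex.real_smul]
    rw [tsum_eq_sum fun x hx => by rw [walkProb_eq_zero H n hx]; simp,
      ← sum_walkProb_mul_exp_eq_walkCharFun hb]
    rfl
  · refine Integrable.of_bound (by fun_prop) 1 (Eventually.of_forall fun x => ?_)
    rw [← Complex.ofReal_mul, Complex.norm_exp_ofReal_mul_I]

section

variable {H : Matrix.unitaryGroup (Fin 2) ℂ} {β : ℝ} {t d M : ℕ → ℕ}

theorem tendsto_walkCharFun_pow_gaussian (hb : H.1 0 1 ≠ 0) (htdM : ∀ n, t n = d n * M n)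
    (ht : Tendsto t atTop atTop) (hβ : β < 1)
    (hd : (fun n => (d n : ℝ)) ~[atTop] (fun n => (t n : ℝ) ^ β)) {v : ℝ}
    (hv : Tendsto (fun n => walkSecondMoment H (d n) / (d n : ℝ) ^ 2) atTop (𝓝 v)) (s : ℝ) :
    Tendsto (fun n => walkCharFun H (d n) (s / (t n : ℝ) ^ ((1 + β) / 2)) ^ M n) atTop
      (𝓝 (Real.exp (-(s ^ 2 * v / 2)))) := by
  have ht' : Tendsto (fun n => (t n : ℝ)) atTop atTop := tendsto_natCast_atTop_atTop.comp ht
  have htpos : ∀ᶠ n in atTop, 0 < (t n : ℝ) := ht'.eventually_gt_atTop 0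
  have hratio : Tendsto (fun n => (d n : ℝ) / (t n : ℝ) ^ β) atTop (𝓝 1) :=
    (Asymptotics.isEquivalent_iff_tendsto_one (by
      filter_upwards [htpos] with n hn
      exact (Real.rpow_pos_of_pos hn β).ne')).1 hd
  set ξ : ℕ → ℝ := fun n => s / (t n : ℝ) ^ ((1 + β) / 2) with hξ
  have hsq : ∀ n, 0 < (t n : ℝ) → ((t n : ℝ) ^ ((1 + β) / 2)) ^ 2 = t n * (t n : ℝ) ^ β := by
    intro n hn
    rw [← Real.rpow_natCast, ← Real.rpow_mul hn.le]
    nth_rewrite 2 [← Real.rpow_one (t n : ℝ)]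
    rw [← Real.rpow_add hn]
    congr 1
    push_cast
    ring
  have hξsq : ∀ n, 0 < (t n : ℝ) → ξ n ^ 2 = s ^ 2 / (t n * (t n : ℝ) ^ β) := by
    intro n hn
    simp only [hξ, div_pow, hsq n hn]
  -- (ξd)² = s² (d/t^β)² t^{β-1}, which vanishes in the limit because β < 1.
  have hA : Tendsto (fun n => (ξ n * d n) ^ 2) atTop (𝓝 0) := by
    have h1 : Tendsto (fun n => (t n : ℝ) ^ (-(1 - β))) atTop (𝓝 0) :=
      (tendsto_rpow_neg_atTop (by linarith)).comp ht'
    have h2 := ((hratio.pow 2).mul h1).const_mul (s ^ 2)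
    rw [mul_zero, mul_zero] at h2
    refine h2.congr' ?_
    filter_upwards [htpos] with n hn
    have := Real.rpow_pos_of_pos hn β
    rw [mul_pow, hξsq n hn, neg_sub, Real.rpow_sub_one hn.ne']
    field_simp
  -- By t = dM this product is exactly s² d/t^β.
  have hMA : Tendsto (fun n => M n * (ξ n * d n) ^ 2) atTop (𝓝 (s ^ 2)) := by
    have h2 := hratio.const_mul (s ^ 2)
    rw [mul_one] at h2
    refine h2.congr' ?_
    filter_upwards [htpos] with n hn
    have := Real.rpow_pos_of_pos hn β
    have htn : (t n : ℝ) = d n * M n := by exact_mod_cast htdM n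
    have hdM : (d n : ℝ) * M n ≠ 0 := htn ▸ hn.ne'
    have hM0 := right_ne_zero_of_mul hdM
    have hd0 := left_ne_zero_of_mul hdM
    rw [mul_pow, hξsq n hn]
    generalize (t n : ℝ) ^ β = T at *
    rw [htn]
    field_simp
  set m : ℕ → ℝ := fun n => walkSecondMoment H (d n) / (d n : ℝ) ^ 2 with hm
  set err : ℕ → ℝ := fun n => 1 - walkCharFun H (d n) (ξ n) - (ξ n * d n) ^ 2 * m n / 2 with herr
  have herr_le : ∀ᶠ n in atTop, ‖err n‖ ≤ (ξ n * d n) ^ 2 * (ξ n * d n) ^ 2 := by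
    filter_upwards [htpos, hA.eventually_lt_const one_pos] with n hn hA1
    have htn : (t n : ℝ) = d n * M n := by exact_mod_cast htdM n
    have hd0 : (d n : ℝ) ≠ 0 := left_ne_zero_of_mul (htn ▸ hn.ne')
    have hle : |ξ n| * d n ≤ 1 := by
      rw [sq_lt_one_iff_abs_lt_one, abs_mul, Nat.abs_cast] at hA1
      exact hA1.le
    have h := abs_walkCharFun_sub_le hb hle
    have hmul : (ξ n * d n) ^ 2 * m n = ξ n ^ 2 * walkSecondMoment H (d n) := by
      rw [hm]
      field_simp
    rw [Real.norm_eq_abs, herr, ← abs_neg]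
    simp only [hmul]
    refine (le_of_eq ?_).trans (h.trans (le_of_eq (by ring)))
    congr 1
    ring
  have herr0 : Tendsto err atTop (𝓝 0) :=
    squeeze_zero_norm' herr_le (by simpa using hA.mul hA)
  have hMerr : Tendsto (fun n => M n * err n) atTop (𝓝 0) := by
    refine squeeze_zero_norm' ?_ (by simpa using hMA.mul hA)
    filter_upwards [herr_le] with n hn
    rw [norm_mul, Real.norm_natCast, mul_assoc]
    gcongr
  have hx : Tendsto (fun n => 1 - walkCharFun H (d n) (ξ n)) atTop (𝓝 0) := by
    have h := ((hA.mul hv).div_const 2).add herr0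
    rw [zero_mul, zero_div, zero_add] at h
    refine h.congr fun n => ?_
    simp only [herr]
    ring
  have hMx : Tendsto (fun n => M n * (1 - walkCharFun H (d n) (ξ n))) atTop
      (𝓝 (s ^ 2 * v / 2)) := by
    have h := ((hMA.mul hv).div_const 2).add hMerr
    rw [add_zero] at h
    refine h.congr fun n => ?_
    simp only [herr]
    ring
  refine (tendsto_one_sub_pow_exp hx hMx).congr fun n => ?_
  rw [sub_sub_cancel]

theorem tendsto_walkCharFun_pow_konno (hb : H.1 0 1 ≠ 0) (htdM : ∀ n, t n = d n * M n)
    (ht : Tendsto t atTop atTop) (hd : (fun n => (d n : ℝ)) ~[atTop] (fun n => (t n : ℝ)))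
    (s : ℝ) :
    Tendsto (fun n => walkCharFun H (d n) (s / t n) ^ M n) atTop (𝓝 (1 / (2 * Real.pi) *
      ∫ κ in (0 : ℝ)..2 * Real.pi, Real.cos (s * groupVelocity ‖H.1 0 0‖ κ))) := by
  have ht' : Tendsto (fun n => (t n : ℝ)) atTop atTop := tendsto_natCast_atTop_atTop.comp ht
  have htpos : ∀ᶠ n in atTop, 0 < (t n : ℝ) := ht'.eventually_gt_atTop 0
  have hratio : Tendsto (fun n => (d n : ℝ) / (t n : ℝ)) atTop (𝓝 1) :=
    (Asymptotics.isEquivalent_iff_tendsto_one (htpos.mono fun n hn => hn.ne')).1 hd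
  -- Eventually d/t > 1/2, so t = dM gives M < 2, while t > 0 excludes M = 0.
  have hM : ∀ᶠ n in atTop, M n = 1 := by
    filter_upwards [htpos, hratio.eventually_const_lt (show (1 / 2 : ℝ) < 1 by norm_num)]
      with n hn hlt
    have htn : (t n : ℝ) = d n * M n := by exact_mod_cast htdM n
    have hM0 : M n ≠ 0 := by
      intro h
      rw [h] at htn
      simp [htn] at hn
    have hd0 : (0 : ℝ) < d n := by
      refine lt_of_le_of_ne (Nat.cast_nonneg _) fun h => ?_
      rw [← h] at htn
      simp [htn] at hn
    rw [lt_div_iff₀ hn, htn] at hlt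
    have hlt2 : (M n : ℝ) < 2 := by
      by_contra! h
      nlinarith
    have : M n < 2 := by exact_mod_cast hlt2
    omega
  have hdt : ∀ᶠ n in atTop, t n = d n := hM.mono fun n hn => by rw [htdM, hn, mul_one]
  have hd_top : Tendsto d atTop atTop := ht.congr' hdt
  refine (tendsto_walkCharFun hb hd_top s).congr' ?_
  filter_upwards [hM, hdt] with n h1 h2
  rw [h1, h2, pow_one]

/-- Independence makes the characteristic function of the sum an M-th power; Lévy's continuity
theorem does the rest, even though the probability space varies with n. -/
theorem tendstoInDistribution_of_tendsto_walkCharFun_pow (hb : H.1 0 1 ≠ 0)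
    {Ω : ℕ → Type*} [∀ n, MeasurableSpace (Ω n)]
    {P : ∀ n, Measure (Ω n)} [∀ n, IsProbabilityMeasure (P n)]
    {Y : ∀ n, Fin (M n) → Ω n → ℤ} (hmeas : ∀ n i, Measurable (Y n i))
    (hindep : ∀ n, iIndepFun (Y n) (P n))
    (hlaw : ∀ n i x, (P n).real {ω | Y n i ω = x} = walkProb H (d n) x)
    {X : ∀ n, Ω n → ℤ} (hX : ∀ n ω, X n ω = ∑ i, Y n i ω) (τ : ℕ → ℝ)
    (μ : Measure ℝ) [IsProbabilityMeasure μ]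
    (h : ∀ s, Tendsto (fun n => ((walkCharFun H (d n) (s / τ n) ^ M n : ℝ) : ℂ)) atTop
      (𝓝 (charFun μ s))) :
    TendstoInDistribution (fun n ω => (X n ω : ℝ) / τ n) atTop id P μ := by
  have hXm : ∀ n, Measurable (X n) := fun n => by
    rw [show X n = fun ω => ∑ i, Y n i ω from funext (hX n)]
    exact Finset.measurable_sum _ fun i _ => hmeas n i
  have hXr : ∀ n, Measurable fun ω => (X n ω : ℝ) := fun n => by
    have := hXm n
    fun_prop
  refine ⟨fun n => ((hXr n).div_const _).aemeasurable, aemeasurable_id, ?_⟩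
  refine ProbabilityMeasure.tendsto_iff_tendsto_charFun.2 fun s => ?_
  simp only [ProbabilityMeasure.coe_mk, Measure.map_id]
  refine (h s).congr fun n => ?_
  have hchar : charFun ((P n).map fun ω => (X n ω : ℝ)) (s / τ n) =
      ((walkCharFun H (d n) (s / τ n) ^ M n : ℝ) : ℂ) := by
    have hsum : (fun ω => (X n ω : ℝ)) = fun ω => ∑ i, (Y n i ω : ℝ) := by
      funext ω
      rw [hX]
      push_cast
      rfl
    have hYr : ∀ i, Measurable fun ω => (Y n i ω : ℝ) := fun i => by
      have := hmeas n i
      fun_prop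
    have hind : iIndepFun (fun i ω => (Y n i ω : ℝ)) (P n) :=
      (hindep n).comp (fun _ x => (x : ℝ)) fun _ => by fun_prop
    rw [hsum, hind.charFun_map_fun_sum_eq_prod fun i => (hYr i).aemeasurable]
    simp [charFun_map_of_walkProb hb (hmeas n _) (hlaw n _)]
  rw [← hchar, div_eq_inv_mul, ← charFun_map_mul_comp (hXr n).aemeasurable]
  simp only [div_eq_inv_mul]

end

theorem theorem1
    -- the coin, with all four entries nonzero
    (H : Matrix.unitaryGroup (Fin 2) ℂ)
    (hH : H.1 0 0 * H.1 0 1 * H.1 1 0 * H.1 1 1 ≠ 0)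
    -- final times `t = d M` tending to infinity, with `d ~ t ^ β`
    (β : ℝ) (t d M : ℕ → ℕ) (htdM : ∀ n, t n = d n * M n) (ht : Tendsto t atTop atTop)
    (hd : (fun n => (d n : ℝ)) ~[atTop] (fun n => (t n : ℝ) ^ β))
    -- for each `n`, independent blocks distributed as the walk after `d n` steps
    {Ω : ℕ → Type*} [∀ n, MeasurableSpace (Ω n)]
    (P : ∀ n, Measure (Ω n)) [∀ n, IsProbabilityMeasure (P n)]
    (Y : ∀ n, Fin (M n) → Ω n → ℤ) (hmeas : ∀ n i, Measurable (Y n i))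
    (hindep : ∀ n, iIndepFun (Y n) (P n))
    (hlaw : ∀ n i x, (P n).real {ω | Y n i ω = x} = walkProb H (d n) x)
    -- the position at the final time
    (X : ∀ n, Ω n → ℤ) (hX : ∀ n ω, X n ω = ∑ i, Y n i ω) :
    (β = 0 →
      TendstoInDistribution (fun n ω => (X n ω : ℝ) / (t n : ℝ) ^ ((1 + β) / 2)) atTop
        id P (gaussianReal 0 1)) ∧
    (0 < β → β < 1 →
      TendstoInDistribution (fun n ω => (X n ω : ℝ) / (t n : ℝ) ^ ((1 + β) / 2)) atTop
        id P (gaussianReal 0 (Real.toNNReal (1 - √(1 - ‖H.1 0 0‖ ^ 2))))) ∧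
    (β = 1 →
      ∃ _ : IsProbabilityMeasure (konnoLaw ‖H.1 0 0‖),
        TendstoInDistribution (fun n ω => (X n ω : ℝ) / (t n : ℝ) ^ ((1 + β) / 2)) atTop
          id P (konnoLaw ‖H.1 0 0‖)) := by
  have hb : H.1 0 1 ≠ 0 := fun h => hH (by rw [h]; ring)
  have ha : 0 < ‖H.1 0 0‖ := norm_pos_iff.2 fun h => hH (by rw [h]; ring)
  have ha1 := (exists_trace_walkSymbol_eq_walkKernel H hb).1
  have ht' : Tendsto (fun n => (t n : ℝ)) atTop atTop := tendsto_natCast_atTop_atTop.comp ht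
  -- Both Gaussian regimes follow from this; they differ only in the limit of the normalized second
  -- moment.
  have hgauss : ∀ v : NNReal, β < 1 →
      Tendsto (fun n => walkSecondMoment H (d n) / (d n : ℝ) ^ 2) atTop (𝓝 v) →
      TendstoInDistribution (fun n ω => (X n ω : ℝ) / (t n : ℝ) ^ ((1 + β) / 2)) atTop
        id P (gaussianReal 0 v) := by
    intro v hβ hv
    refine tendstoInDistribution_of_tendsto_walkCharFun_pow hb hmeas hindep hlaw hX _ _
      fun s => ?_
    rw [charFun_gaussianReal]
    convert! (Complex.continuous_ofReal.tendsto _).comp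
      (tendsto_walkCharFun_pow_gaussian hb htdM ht hβ hd hv s) using 2
    push_cast
    congr 1
    ring
  refine ⟨fun hβ => ?_, fun hβ0 hβ1 => ?_, fun hβ => ?_⟩
  · refine hgauss 1 (by linarith) ?_
    -- For β = 0 the natural numbers d converge to 1, hence are eventually equal to 1.
    have hd1 : ∀ᶠ n in atTop, d n = 1 := by
      have h1 : Tendsto (fun n => (d n : ℝ)) atTop (𝓝 1) := by
        have h := hd
        simp only [hβ, Real.rpow_zero] at h
        exact (Asymptotics.isEquivalent_const_iff_tendsto one_ne_zero).1 h
      filter_upwards [h1.eventually_const_lt (show (1 / 2 : ℝ) < 1 by norm_num),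
        h1.eventually_lt_const (show (1 : ℝ) < 2 by norm_num)] with n hlo hhi
      have : d n < 2 := by exact_mod_cast hhi
      have : d n ≠ 0 := fun h => by norm_num [h] at hlo
      omega
    refine tendsto_const_nhds.congr' ?_
    filter_upwards [hd1] with n hn
    simp [hn, walkSecondMoment_one hb]
  · refine hgauss _ hβ1 ?_
    rw [Real.coe_toNNReal _ (sub_nonneg.2 (Real.sqrt_le_one.2 (by nlinarith)))]
    refine tendsto_walkSecondMoment_div_sq hb ?_
    have h := hd.symm.tendsto_atTop ((tendsto_rpow_atTop hβ0).comp ht')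
    exact tendsto_natCast_atTop_iff.1 h
  · refine ⟨isProbabilityMeasure_konnoLaw ha ha1, ?_⟩
    have := isProbabilityMeasure_konnoLaw ha ha1
    refine tendstoInDistribution_of_tendsto_walkCharFun_pow hb hmeas hindep hlaw hX _ _
      fun s => ?_
    have h := tendsto_walkCharFun_pow_konno hb htdM ht (by simpa [hβ] using hd) s
    rw [charFun_konnoLaw ha ha1]
    simp only [hβ, add_self_div_two, Real.rpow_one]
    exact (Complex.continuous_ofReal.tendsto _).comp h
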